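/- Let $\mathbb K$ be a field and let $\mathbf{Op}$ be the category of finitely generated binary quadratic symmetric operads over $\mathbb K$. An object $\mathcal O$ is given by a finite-dimensional $\mathbb K[S_2]$-module $E=\mathcal O(2)$ of binary operations and an $S_3$-stable space of relations $R\subset\mathcal T(E)(3)$, where $\mathcal T(E)(3)$ is the arity three part of the free operad on $E$; write $\mathcal T(E)(3)=\bigoplus_{k\in\mathbb Z/3}E\otimes E$, with $\mu\otimes\nu$ in the $k$-th summand being the operation $\mu(\nu(x_k,x_{k+1}),x_{k+2})$. A morphism is an $S_2$-equivariant linear map of binary operations that sends relations to relations. The Manin black product $\mathcal P\bullet\mathcal O$ has binary operations $\mathcal P(2)\otimes\mathcal O(2)\otimes\mathrm{sgn}_2$ and relations spanned by $\Psi(r\otimes s)$, where $r$, $s$ are relations of $\mathcal P$, $\mathcal O$, and $\Psi$ sends $(\mu\otimes\nu)\otimes(\mu'\otimes\nu')$ to $(\mu\otimes\mu')\otimes(\nu\otimes\nu')$ in the $k$-th summand if both factors lie in the $k$-th summand, and to $0$ if they lie in different summands. For a vector space $V$ let $C^*(\Delta_1;V)$ be the complex of non-degenerate cochains of the standard $1$-simplex,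 and let $C^*(\Delta_1,X;V)$ be the subcomplex of cochains vanishing on a closed subset $X$ (a subcomplex of $\Delta_1$); let $v_l$ be the left vertex. A dg $\mathcal O$-algebra structure on $C^*(\Delta_1;V)$ is *local* if $C^*(\Delta_1,X;V)$ is a dg ideal for every closed $X\subset\Delta_1$. Its *associated $\mathcal O$-algebra* is the space $V$ with the products of $0$-cochains supported on the right vertex. (a) There is a functor $\mathrm{Ass}_\bullet:\mathbf{Op}\to\mathbf{Op}$ such that an $\mathrm{Ass}_\bullet(\mathcal O)$-algebra structure on a vector space $V$ is the same as a local dg $\mathcal O$-algebra structure on $C^*(\Delta_1;V)$; that is, there are bijections between the two sets of structures such that a linear map $V\to W$ is a morphism of $\mathrm{Ass}_\bullet(\mathcal O)$-algebras if and only if the induced map of cochains is a morphism of $\mathcal O$-algebras, and these bijections are natural in $\mathcal O$. For every such functor there is a natural isomorphism $\mathrm{Ass}_\bullet(\mathcal O)\cong\mathcal{A}ss\bullet\mathcal O$. (b) There is a functor $\mathrm{Com}_\bullet:\mathbf{Op}\to\mathbf{Op}$ such that, in the same sense, a $\mathrm{Com}_\bullet(\mathcal O)$-algebra structure on $V$ is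 the same as a local dg $\mathcal O$-algebra structure on $C^*(\Delta_1;V)$ whose associated $\mathcal O$-algebra is trivial. For every such functor there is a natural isomorphism $\mathrm{Com}_\bullet(\mathcal O)\cong\mathcal{C}om\bullet\mathcal O$. (c) There is a functor $\mathrm{preLie}_\bullet:\mathbf{Op}\to\mathbf{Op}$ such that, in the same sense, a $\mathrm{preLie}_\bullet(\mathcal O)$-algebra structure on $V$ is the same as a dg $\mathcal O$-algebra structure on $C^*(\Delta_1,v_l;V)$. For every such functor there is a natural isomorphism $\mathrm{preLie}_\bullet(\mathcal O)\cong pre\mathcal{L}ie\bullet\mathcal O$. Here $\mathcal{A}ss$, $\mathcal{C}om$ and $pre\mathcal{L}ie$ are the operads of associative, commutative associative and right pre-Lie algebras. -/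

import Mathlib

open CategoryTheory TensorProduct

universe u

namespace BQ

/-! ## Ternary operations generated by binary ones -/

section Ternary

variable {K : Type u} [Field K]

/-- The arity three part of the free operad on a space `E` of binary generators.  It consists of
three copies of `E ⊗ E`; the element `μ ⊗ ν` of the copy with index `k : Fin 3` stands for the
ternary operation `μ (ν (x k, x (k + 1)), x (k + 2))` in the variables `x 0, x 1, x 2`
(indices modulo three). -/
abbrev Free3 (K : Type u) [Field K] (E : Type u) [AddCommGroup E] [Module K E] : Type u :=
  Fin 3 → E ⊗[K] E

variable {E : Type u} [AddCommGroup E] [Module K E]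
variable {F : Type u} [AddCommGroup F] [Module K F]
variable {E' : Type u} [AddCommGroup E'] [Module K E']
variable {F' : Type u} [AddCommGroup F'] [Module K F']

/-- Renaming the variables, `x i ↦ x (σ i)`, in a ternary operation.  Here `s : E → E` sends a
binary operation to its opposite.  An even `σ` moves the summand of index `k` to the one of index
`σ k`; for an odd `σ` one has
`μ (ν (x (σ k), x (σ (k + 1))), x (σ (k + 2))) = μ ((s ν) (x j, x (j + 1)), x (j + 2))`,
where `j = σ (k + 1) = σ k - 1`. -/
def permute (s : E →ₗ[K] E) (σ : Equiv.Perm (Fin 3)) : Free3 K E →ₗ[K] Free3 K E where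
  toFun t j := if Equiv.Perm.sign σ = 1 then t (σ⁻¹ j)
    else TensorProduct.map LinearMap.id s (t (σ⁻¹ j - 1))
  map_add' t t' := by
    funext j; split_ifs <;> simp_all
  map_smul' c t := by
    funext j; split_ifs <;> simp_all

/-- The map on ternary operations induced by a linear map on binary generators. -/
def map3 (f : E →ₗ[K] F) : Free3 K E →ₗ[K] Free3 K F where
  toFun t k := TensorProduct.map f f (t k)
  map_add' t t' := by funext k; simp
  map_smul' c t := by funext k; simp

/-- The map `Ψ` underlying the Manin black product: it pairs the summands of equal index,
`(μ ∘ₖ ν, μ' ∘ₖ ν') ↦ (μ ⊗ μ') ∘ₖ (ν ⊗ ν')`, and kills the pairs of distinct index. -/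
def Psi : Free3 K E →ₗ[K] Free3 K F →ₗ[K] Free3 K (E ⊗[K] F) :=
  LinearMap.mk₂ K
    (fun r t k => TensorProduct.tensorTensorTensorComm K E E F F (r k ⊗ₜ[K] t k))
    (fun r r' t => by funext k; simp [TensorProduct.add_tmul])
    (fun c r t => by
      funext k; simp only [Pi.smul_apply]; rw [← TensorProduct.smul_tmul', map_smul])
    (fun r t t' => by funext k; simp [TensorProduct.tmul_add])
    (fun c r t => by funext k; simp)

theorem psi_apply (r : Free3 K E) (t : Free3 K F) (k : Fin 3) :
    Psi r t k = TensorProduct.tensorTensorTensorComm K E E F F (r k ⊗ₜ[K] t k) := rfl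

theorem map_map_id {s : E →ₗ[K] E} (hs : ∀ μ, s (s μ) = μ) (t : E ⊗[K] E) :
    TensorProduct.map LinearMap.id s (TensorProduct.map LinearMap.id s t) = t := by
  induction t using TensorProduct.induction_on with
  | zero => simp
  | tmul a b => simp [hs]
  | add a b ha hb => simp [ha, hb]

theorem permute_permute {s : E →ₗ[K] E} (hs : ∀ μ, s (s μ) = μ) (σ ρ : Equiv.Perm (Fin 3))
    (t : Free3 K E) : permute s σ (permute s ρ t) = permute s (σ * ρ) t := by
  have h0 : ∀ σ ρ : Equiv.Perm (Fin 3), ∀ j : Fin 3, (σ * ρ)⁻¹ j = ρ⁻¹ (σ⁻¹ j) := by decide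
  have h1 : ∀ σ ρ : Equiv.Perm (Fin 3), ∀ j : Fin 3, Equiv.Perm.sign σ ≠ 1 →
      Equiv.Perm.sign ρ = 1 → ρ⁻¹ (σ⁻¹ j - 1) = ρ⁻¹ (σ⁻¹ j) - 1 := by decide
  have h2 : ∀ σ ρ : Equiv.Perm (Fin 3), ∀ j : Fin 3, Equiv.Perm.sign σ ≠ 1 →
      Equiv.Perm.sign ρ ≠ 1 → ρ⁻¹ (σ⁻¹ j - 1) - 1 = ρ⁻¹ (σ⁻¹ j) := by decide
  have h3 : ∀ σ : Equiv.Perm (Fin 3), Equiv.Perm.sign σ ≠ 1 → Equiv.Perm.sign σ = -1 := by decide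
  funext j
  simp only [permute, LinearMap.coe_mk, AddHom.coe_mk, h0, map_mul]
  by_cases hσ : Equiv.Perm.sign σ = 1 <;> by_cases hρ : Equiv.Perm.sign ρ = 1
  · simp only [hσ, hρ, mul_one, if_true]
  · rw [if_pos hσ, if_neg hρ, if_neg (by rw [hσ, one_mul]; exact hρ)]
  · rw [if_neg hσ, if_pos hρ, if_neg (by rw [hρ, mul_one]; exact hσ), h1 σ ρ j hσ hρ]
  · rw [if_neg hσ, if_neg hρ, if_pos (by rw [h3 σ hσ, h3 ρ hρ]; rfl), h2 σ ρ j hσ hρ,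
      map_map_id hs]

theorem permute_psi (s : E →ₗ[K] E) (t : F →ₗ[K] F) (σ : Equiv.Perm (Fin 3))
    (r : Free3 K E) (q : Free3 K F) :
    permute (-(TensorProduct.map s t)) σ (Psi r q) = Psi (permute s σ r) (permute t σ q) ∨
    permute (-(TensorProduct.map s t)) σ (Psi r q) = -Psi (permute s σ r) (permute t σ q) := by
  have key : ∀ (a : E ⊗[K] E) (b : F ⊗[K] F),
      TensorProduct.map LinearMap.id (-(TensorProduct.map s t))
        (TensorProduct.tensorTensorTensorComm K E E F F (a ⊗ₜ[K] b)) =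
      -TensorProduct.tensorTensorTensorComm K E E F F
        (TensorProduct.map LinearMap.id s a ⊗ₜ[K] TensorProduct.map LinearMap.id t b) := by
    intro a b
    induction a using TensorProduct.induction_on with
    | zero => simp
    | add a a' ha ha' => simp only [TensorProduct.add_tmul, map_add, ha, ha', neg_add]
    | tmul x y =>
      induction b using TensorProduct.induction_on with
      | zero => simp
      | add b b' hb hb' => simp only [TensorProduct.tmul_add, map_add, hb, hb', neg_add]
      | tmul z w => simp [TensorProduct.tmul_neg]
  by_cases hσ : Equiv.Perm.sign σ = 1
  · left
    funext j
    simp [permute, psi_apply, hσ]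
  · right
    funext j
    simp only [permute, psi_apply, hσ, LinearMap.coe_mk, AddHom.coe_mk, if_false, Pi.neg_apply]
    exact key _ _

theorem map3_psi (f : E →ₗ[K] E') (g : F →ₗ[K] F') (r : Free3 K E) (q : Free3 K F) :
    map3 (TensorProduct.map f g) (Psi r q) = Psi (map3 f r) (map3 g q) := by
  have key : ∀ (a : E ⊗[K] E) (b : F ⊗[K] F),
      TensorProduct.map (TensorProduct.map f g) (TensorProduct.map f g)
        (TensorProduct.tensorTensorTensorComm K E E F F (a ⊗ₜ[K] b)) =
      TensorProduct.tensorTensorTensorComm K E' E' F' F'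
        (TensorProduct.map f f a ⊗ₜ[K] TensorProduct.map g g b) := by
    intro a b
    induction a using TensorProduct.induction_on with
    | zero => simp
    | add a a' ha ha' => simp only [TensorProduct.add_tmul, map_add, ha, ha']
    | tmul x y =>
      induction b using TensorProduct.induction_on with
      | zero => simp
      | add b b' hb hb' => simp only [TensorProduct.tmul_add, map_add, hb, hb']
      | tmul z w => simp
  funext k
  exact key _ _

theorem map3_id (r : Free3 K E) : map3 (LinearMap.id : E →ₗ[K] E) r = r := by
  funext k; simp [map3]

theorem map3_comp (g : F →ₗ[K] F') (f : E →ₗ[K] F) (r : Free3 K E) :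
    map3 (g ∘ₗ f) r = map3 g (map3 f r) := by
  funext k; simp [map3, TensorProduct.map_comp]

end Ternary

/-! ## The category of finitely generated binary quadratic operads -/

/-- A finitely generated binary quadratic symmetric operad over `K`, given by its finite
dimensional space `E` of binary operations, the action `swap` of the transposition on `E`
(the opposite operation), and the `S₃`-stable space `R` of its relations among the ternary
operations generated by `E`. -/
structure QuadOperad (K : Type u) [Field K] where
  E : Type u
  [addCommGroup : AddCommGroup E]
  [module : Module K E]
  [finite : Module.Finite K E]
  swap : E →ₗ[K] E
  swap_swap : ∀ μ, swap (swap μ) = μ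
  R : Submodule K (Free3 K E)
  permute_mem : ∀ (σ : Equiv.Perm (Fin 3)) (r : Free3 K E), r ∈ R → permute swap σ r ∈ R

attribute [instance] QuadOperad.addCommGroup QuadOperad.module QuadOperad.finite

variable {K : Type u} [Field K]

/-- A morphism of binary quadratic operads: an equivariant linear map between the spaces of
binary operations that sends relations to relations.  (The arity two component of a morphism
of operads is such a map, and determines the morphism.) -/
@[ext]
structure QuadOperad.Hom (O P : QuadOperad K) where
  map : O.E →ₗ[K] P.E
  map_swap : ∀ μ, map (O.swap μ) = P.swap (map μ)
  map_rel : ∀ r ∈ O.R, map3 map r ∈ P.R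

instance : Category (QuadOperad K) where
  Hom := QuadOperad.Hom
  id O := ⟨LinearMap.id, fun _ => rfl, fun r hr => by rwa [map3_id]⟩
  comp f g := ⟨g.map ∘ₗ f.map,
    fun μ => by simp only [LinearMap.comp_apply]; rw [f.map_swap, g.map_swap],
    fun r hr => by rw [map3_comp]; exact g.map_rel _ (f.map_rel _ hr)⟩

/-- The operad with binary operations `E` and with relations generated by the set `S`. -/
def QuadOperad.ofRelations (E : Type u) [AddCommGroup E] [Module K E] [Module.Finite K E]
    (s : E →ₗ[K] E) (hs : ∀ μ, s (s μ) = μ) (S : Set (Free3 K E)) : QuadOperad K where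
  E := E
  swap := s
  swap_swap := hs
  R := Submodule.span K {t | ∃ (σ : Equiv.Perm (Fin 3)) (r : Free3 K E), r ∈ S ∧ t = permute s σ r}
  permute_mem σ r hr := by
    induction hr using Submodule.span_induction with
    | mem t ht =>
      obtain ⟨ρ, r, hr, rfl⟩ := ht
      rw [permute_permute hs]
      exact Submodule.subset_span ⟨_, r, hr, rfl⟩
    | zero => simp
    | add a b _ _ ha hb => rw [map_add]; exact Submodule.add_mem _ ha hb
    | smul c a _ ha => rw [map_smul]; exact Submodule.smul_mem _ c ha

/-- The operation `(x, y) ↦ x y` of the free non-symmetric product. -/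
def prodOp (K : Type u) [Field K] : K × K := (1, 0)

/-- The opposite operation `(x, y) ↦ y x`. -/
def oppOp (K : Type u) [Field K] : K × K := (0, 1)

/-- The exchange of a non-symmetric product and its opposite. -/
def flipOp (K : Type u) [Field K] : (K × K) →ₗ[K] (K × K) :=
  LinearMap.prod (LinearMap.snd K K K) (LinearMap.fst K K K)

/-- The operad of associative algebras: a product without symmetry, with the relation
`(x₀ x₁) x₂ - x₀ (x₁ x₂) = 0`. -/
def Ass (K : Type u) [Field K] : QuadOperad K :=
  QuadOperad.ofRelations (K × K) (flipOp K) (fun _ => rfl)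
    {![prodOp K ⊗ₜ prodOp K, -(oppOp K ⊗ₜ prodOp K), 0]}

/-- The operad of commutative associative algebras: a commutative product, with the relation
`(x₀ x₁) x₂ - (x₁ x₂) x₀ = 0`. -/
def Com (K : Type u) [Field K] : QuadOperad K :=
  QuadOperad.ofRelations K LinearMap.id (fun _ => rfl)
    {![(1 : K) ⊗ₜ (1 : K), -((1 : K) ⊗ₜ (1 : K)), 0]}

/-- The operad of right pre-Lie algebras: a product without symmetry, with the relation
`(x₀ x₁) x₂ - x₀ (x₁ x₂) - (x₀ x₂) x₁ + x₀ (x₂ x₁) = 0`. -/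
def PreLie (K : Type u) [Field K] : QuadOperad K :=
  QuadOperad.ofRelations (K × K) (flipOp K) (fun _ => rfl)
    {![prodOp K ⊗ₜ prodOp K, -(oppOp K ⊗ₜ prodOp K) + oppOp K ⊗ₜ oppOp K,
      -(prodOp K ⊗ₜ oppOp K)]}

/-- The Manin black product `P • O`: the space of binary operations is `P(2) ⊗ O(2) ⊗ sgn₂`, and
the space of relations is spanned by the `Ψ (r, t)` for relations `r` of `P` and `t` of `O`. -/
def blackProduct (P O : QuadOperad K) : QuadOperad K where
  E := P.E ⊗[K] O.E
  swap := -(TensorProduct.map P.swap O.swap)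
  swap_swap t := by
    induction t using TensorProduct.induction_on with
    | zero => simp
    | tmul a b => simp [P.swap_swap, O.swap_swap]
    | add a b ha hb => rw [map_add, map_add, ha, hb]
  R := Submodule.span K {w | ∃ r ∈ P.R, ∃ t ∈ O.R, w = Psi r t}
  permute_mem σ w hw := by
    induction hw using Submodule.span_induction with
    | mem w hw =>
      obtain ⟨r, hr, t, ht, rfl⟩ := hw
      have hmem : Psi (permute P.swap σ r) (permute O.swap σ t) ∈
          Submodule.span K {w | ∃ r ∈ P.R, ∃ t ∈ O.R, w = Psi r t} :=
        Submodule.subset_span ⟨_, P.permute_mem σ r hr, _, O.permute_mem σ t ht, rfl⟩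
      rcases permute_psi P.swap O.swap σ r t with h | h
      · rw [h]; exact hmem
      · rw [h]; exact Submodule.neg_mem _ hmem
    | zero => simp
    | add a b _ _ ha hb => rw [map_add]; exact Submodule.add_mem _ ha hb
    | smul c a _ ha => rw [map_smul]; exact Submodule.smul_mem _ c ha

theorem map3_mem_black {E F F' : Type u} [AddCommGroup E] [Module K E] [AddCommGroup F] [Module K F]
    [AddCommGroup F'] [Module K F'] (R : Submodule K (Free3 K E)) (S : Submodule K (Free3 K F))
    (S' : Submodule K (Free3 K F')) (f : F →ₗ[K] F') (hf : ∀ t ∈ S, map3 f t ∈ S')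
    (w : Free3 K (E ⊗[K] F)) (hw : w ∈ Submodule.span K {w | ∃ r ∈ R, ∃ t ∈ S, w = Psi r t}) :
    map3 (TensorProduct.map LinearMap.id f) w ∈
      Submodule.span K {w | ∃ r ∈ R, ∃ t ∈ S', w = Psi r t} := by
  induction hw using Submodule.span_induction with
  | mem w hw =>
    obtain ⟨r, hr, t, ht, rfl⟩ := hw
    refine Submodule.subset_span ⟨r, hr, _, hf t ht, ?_⟩
    rw [map3_psi, map3_id]
  | zero => simp
  | add a b _ _ ha hb => rw [map_add]; exact Submodule.add_mem _ ha hb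
  | smul c a _ ha => rw [map_smul]; exact Submodule.smul_mem _ c ha

/-- The functor `P • -`. -/
def black (P : QuadOperad K) : QuadOperad K ⥤ QuadOperad K where
  obj O := blackProduct P O
  map {O O'} f :=
    { map := TensorProduct.map LinearMap.id (QuadOperad.Hom.map f)
      map_swap := fun t => by
        change (TensorProduct.map LinearMap.id (QuadOperad.Hom.map f))
            (-(TensorProduct.map P.swap O.swap t)) =
          -(TensorProduct.map P.swap O'.swap
            (TensorProduct.map LinearMap.id (QuadOperad.Hom.map f) t))
        induction t using TensorProduct.induction_on with
        | zero => simp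
        | tmul a b => simp [QuadOperad.Hom.map_swap f]
        | add a b ha hb => simp only [map_add, neg_add, ha, hb]
      map_rel := map3_mem_black P.R O.R O'.R (QuadOperad.Hom.map f) (QuadOperad.Hom.map_rel f) }
  map_id O := by
    apply QuadOperad.Hom.ext
    exact TensorProduct.map_id
  map_comp f g := by
    apply QuadOperad.Hom.ext
    exact TensorProduct.ext' fun _ _ => rfl

/-! ## Algebras -/

section Eval

variable {E : Type u} [AddCommGroup E] [Module K E] {F : Type u} [AddCommGroup F] [Module K F]
variable {A : Type u} [AddCommGroup A] [Module K A]

/-- `nest m (μ ⊗ ν) x y z = μ (ν (x, y), z)`, where `m` interprets the elements of `E` as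
products on `A`. -/
def nest (m : E →ₗ[K] A →ₗ[K] A →ₗ[K] A) (t : E ⊗[K] E) (x y z : A) : A :=
  TensorProduct.lift (LinearMap.mk₂ K (fun μ ν => m μ (m ν x y) z)
    (fun _ _ _ => by simp) (fun _ _ _ => by simp) (fun _ _ _ => by simp)
    (fun _ _ _ => by simp)) t

theorem nest_map (f : F →ₗ[K] E) (m : E →ₗ[K] A →ₗ[K] A →ₗ[K] A) (t : F ⊗[K] F) (x y z : A) :
    nest m (TensorProduct.map f f t) x y z = nest (m ∘ₗ f) t x y z := by
  induction t using TensorProduct.induction_on with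
  | zero => simp [nest]
  | tmul a b => simp [nest]
  | add a b ha hb => simp only [nest, map_add] at ha hb ⊢; rw [ha, hb]

end Eval

section Alg

/-- An `O`-algebra structure on the vector space `V`. -/
@[ext]
structure Alg (O : QuadOperad K) (V : Type u) [AddCommGroup V] [Module K V] where
  mul : O.E →ₗ[K] V →ₗ[K] V →ₗ[K] V
  mul_swap : ∀ (μ : O.E) (x y : V), mul (O.swap μ) x y = mul μ y x
  rel : ∀ r ∈ O.R, ∀ x y z : V,
    nest mul (r 0) x y z + nest mul (r 1) y z x + nest mul (r 2) z x y = 0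

variable {V W : Type u} [AddCommGroup V] [Module K V] [AddCommGroup W] [Module K W]

/-- The linear map `f` is a morphism of `O`-algebras. -/
def Alg.IsHom {O : QuadOperad K} (a : Alg O V) (b : Alg O W) (f : V →ₗ[K] W) : Prop :=
  ∀ (μ : O.E) (x y : V), f (a.mul μ x y) = b.mul μ (f x) (f y)

/-- The `O`-algebra structure underlying a `P`-algebra structure, for a morphism `O ⟶ P`. -/
def Alg.restrict {O P : QuadOperad K} (φ : O ⟶ P) (a : Alg P V) : Alg O V where
  mul := a.mul ∘ₗ QuadOperad.Hom.map φ
  mul_swap μ x y := by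
    simp only [LinearMap.comp_apply]; rw [QuadOperad.Hom.map_swap φ, a.mul_swap]
  rel r hr x y z := by
    have h := a.rel _ (QuadOperad.Hom.map_rel φ r hr) x y z
    simpa only [map3, LinearMap.coe_mk, AddHom.coe_mk, nest_map] using h

end Alg

/-- A cochain complex of vector spaces in non-negative degrees, as a graded space with a
differential of degree one. -/
structure DGModule (K : Type u) [Field K] where
  carrier : Type u
  [addCommGroup : AddCommGroup carrier]
  [module : Module K carrier]
  grade : ℕ → Submodule K carrier
  internal : DirectSum.IsInternal grade
  d : carrier →ₗ[K] carrier
  d_mem : ∀ n, ∀ a ∈ grade n, d a ∈ grade (n + 1)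
  d_d : ∀ a, d (d a) = 0

attribute [instance] DGModule.addCommGroup DGModule.module

/-- A dg `O`-algebra structure on the complex `A`: products of degree zero that satisfy the
Leibniz rule, and the symmetries and relations of `O` with the Koszul signs. -/
@[ext]
structure DGAlg (O : QuadOperad K) (A : DGModule K) where
  mul : O.E →ₗ[K] A.carrier →ₗ[K] A.carrier →ₗ[K] A.carrier
  mul_mem : ∀ (μ : O.E) (i j : ℕ), ∀ a ∈ A.grade i, ∀ b ∈ A.grade j, mul μ a b ∈ A.grade (i + j)
  leibniz : ∀ (μ : O.E) (i : ℕ), ∀ a ∈ A.grade i, ∀ b : A.carrier,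
    A.d (mul μ a b) = mul μ (A.d a) b + (-1 : K) ^ i • mul μ a (A.d b)
  mul_swap : ∀ (μ : O.E) (i j : ℕ), ∀ a ∈ A.grade i, ∀ b ∈ A.grade j,
    mul (O.swap μ) a b = (-1 : K) ^ (i * j) • mul μ b a
  rel : ∀ r ∈ O.R, ∀ i j k : ℕ, ∀ a ∈ A.grade i, ∀ b ∈ A.grade j, ∀ c ∈ A.grade k,
    nest mul (r 0) a b c + (-1 : K) ^ (i * (j + k)) • nest mul (r 1) b c a +
      (-1 : K) ^ (k * (i + j)) • nest mul (r 2) c a b = 0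

/-- The linear map `f` is compatible with the products of two dg `O`-algebras. -/
def DGAlg.IsHom {O : QuadOperad K} {A B : DGModule K} (a : DGAlg O A) (b : DGAlg O B)
    (f : A.carrier →ₗ[K] B.carrier) : Prop :=
  ∀ (μ : O.E) (x y : A.carrier), f (a.mul μ x y) = b.mul μ (f x) (f y)

/-- The dg `O`-algebra underlying a dg `P`-algebra, for a morphism `O ⟶ P`. -/
def DGAlg.restrict {O P : QuadOperad K} {A : DGModule K} (φ : O ⟶ P) (a : DGAlg P A) :
    DGAlg O A where
  mul := a.mul ∘ₗ QuadOperad.Hom.map φ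
  mul_mem μ := a.mul_mem (QuadOperad.Hom.map φ μ)
  leibniz μ := a.leibniz (QuadOperad.Hom.map φ μ)
  mul_swap μ i j x hx y hy := by
    simp only [LinearMap.comp_apply]; rw [QuadOperad.Hom.map_swap φ, a.mul_swap _ i j x hx y hy]
  rel r hr i j k x hx y hy z hz := by
    have h := a.rel _ (QuadOperad.Hom.map_rel φ r hr) i j k x hx y hy z hz
    simpa only [map3, LinearMap.coe_mk, AddHom.coe_mk, nest_map] using h

/-- The subspace `I` is a dg ideal of a dg `O`-algebra. -/
def DGAlg.IsIdeal {O : QuadOperad K} {A : DGModule K} (a : DGAlg O A)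
    (I : Submodule K A.carrier) : Prop :=
  (∀ x ∈ I, A.d x ∈ I) ∧
  ∀ (μ : O.E), ∀ x ∈ I, ∀ y : A.carrier, a.mul μ x y ∈ I ∧ a.mul μ y x ∈ I

/-! ## Cochains of the interval -/

/-- The non-degenerate simplices of the standard one-simplex. -/
inductive Cell : Type
  | left
  | right
  | edge

/-- The dimension of a simplex. -/
def Cell.dim : Cell → ℕ
  | .left => 0
  | .right => 0
  | .edge => 1

/-- A closed subset of the one-simplex, as a set of simplices which is closed under faces. -/
structure ClosedSub where
  cells : Set Cell
  closed : Cell.edge ∈ cells → Cell.left ∈ cells ∧ Cell.right ∈ cells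

/-- The left vertex. -/
def ClosedSub.leftVertex : ClosedSub :=
  ⟨{c | c = Cell.left}, fun h => Cell.noConfusion (show Cell.edge = Cell.left from h)⟩

section Cochains

/-- The differential of the non-degenerate cochains of the one-simplex. -/
def cochainD (K : Type u) [Field K] (V : Type u) [AddCommGroup V] [Module K V] :
    (Cell → V) →ₗ[K] (Cell → V) where
  toFun f c := match c with
    | .left => 0
    | .right => 0
    | .edge => f .right - f .left
  map_add' f g := by
    funext c; cases c <;> simp; abel
  map_smul' k f := by
    funext c; cases c <;> simp [smul_sub]

/-- The cochains which vanish on the simplices in `X`. -/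
def vanishing (K : Type u) [Field K] (V : Type u) [AddCommGroup V] [Module K V] (X : Set Cell) :
    Submodule K (Cell → V) where
  carrier := {f | ∀ c ∈ X, f c = 0}
  add_mem' hf hg c hc := by simp [hf c hc, hg c hc]
  zero_mem' _ _ := rfl
  smul_mem' k f hf c hc := by simp [hf c hc]

/-- The cochains of degree `n`. -/
def cochainGrade (K : Type u) [Field K] (V : Type u) [AddCommGroup V] [Module K V] (n : ℕ) :
    Submodule K (Cell → V) :=
  vanishing K V {c | c.dim ≠ n}

theorem cochainD_mem {V : Type u} [AddCommGroup V] [Module K V] (n : ℕ) (f : Cell → V)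
    (hf : f ∈ cochainGrade K V n) : cochainD K V f ∈ cochainGrade K V (n + 1) := by
  intro c hc
  cases c with
  | left => rfl
  | right => rfl
  | edge =>
    have hn : n ≠ 0 := by rintro rfl; exact hc rfl
    have h1 : f .left = 0 := hf _ (show Cell.dim .left ≠ n from fun h => hn h.symm)
    have h2 : f .right = 0 := hf _ (show Cell.dim .right ≠ n from fun h => hn h.symm)
    simp [cochainD, h1, h2]

theorem cochainD_cochainD {V : Type u} [AddCommGroup V] [Module K V] (f : Cell → V) :
    cochainD K V (cochainD K V f) = 0 := by
  funext c
  cases c <;> simp [cochainD]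

theorem isInternal_of_proj {M : Type u} [AddCommGroup M] [Module K M] (g : ℕ → Submodule K M)
    (p : ℕ → M →ₗ[K] M) (hmem : ∀ n x, p n x ∈ g n) (hid : ∀ n, ∀ x ∈ g n, p n x = x)
    (hne : ∀ m n, m ≠ n → ∀ x ∈ g m, p n x = 0) (hsum : ∀ x, p 0 x + p 1 x = x) :
    DirectSum.IsInternal g := by
  constructor
  · rw [injective_iff_map_eq_zero]
    intro x hx
    have key : ∀ (x : DirectSum ℕ fun n => g n) (n : ℕ),
        p n (DirectSum.coeAddMonoidHom g x) = (x n : M) := by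
      intro x n
      induction x using DirectSum.induction_on with
      | zero => simp
      | of m y =>
        rw [DirectSum.coeAddMonoidHom_of]
        by_cases h : m = n
        · subst h
          rw [hid m y y.2, DirectSum.of_eq_same]
        · rw [hne m n h y y.2, DirectSum.of_eq_of_ne _ _ _ (Ne.symm h)]
          rfl
      | add a b ha hb => rw [map_add, map_add, ha, hb]; rfl
    refine DFinsupp.ext fun n => Subtype.ext ?_
    have h := key x n
    rw [hx, map_zero] at h
    exact h.symm
  · intro x
    refine ⟨DirectSum.of (fun n => g n) 0 ⟨p 0 x, hmem 0 x⟩ +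
      DirectSum.of (fun n => g n) 1 ⟨p 1 x, hmem 1 x⟩, ?_⟩
    rw [map_add, DirectSum.coeAddMonoidHom_of, DirectSum.coeAddMonoidHom_of]
    exact hsum x

/-- The part of degree `n` of a cochain. -/
def cochainProj (K : Type u) [Field K] (V : Type u) [AddCommGroup V] [Module K V] (n : ℕ) :
    (Cell → V) →ₗ[K] (Cell → V) where
  toFun f c := if c.dim = n then f c else 0
  map_add' f g := by funext c; by_cases h : c.dim = n <;> simp [h]
  map_smul' k f := by funext c; by_cases h : c.dim = n <;> simp [h]

section Proj

variable {V : Type u} [AddCommGroup V] [Module K V]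

theorem cochainProj_mem (n : ℕ) (f : Cell → V) : cochainProj K V n f ∈ cochainGrade K V n :=
  fun _ hc => if_neg hc

theorem cochainProj_id (n : ℕ) (f : Cell → V) (hf : f ∈ cochainGrade K V n) :
    cochainProj K V n f = f := by
  funext c
  by_cases h : c.dim = n
  · exact if_pos h
  · exact (if_neg h).trans (hf c h).symm

theorem cochainProj_ne (m n : ℕ) (hmn : m ≠ n) (f : Cell → V) (hf : f ∈ cochainGrade K V m) :
    cochainProj K V n f = 0 := by
  funext c
  by_cases h : c.dim = n
  · exact (if_pos h).trans (hf c (show c.dim ≠ m from fun h' => hmn (h'.symm.trans h)))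
  · exact if_neg h

theorem cochainProj_sum (f : Cell → V) : cochainProj K V 0 f + cochainProj K V 1 f = f := by
  funext c
  cases c <;> simp [cochainProj, Cell.dim]

end Proj

/-- The complex `C*(Δ₁; V)` of non-degenerate cochains of the one-simplex with coefficients
in `V`. -/
def cochains (K : Type u) [Field K] (V : Type u) [AddCommGroup V] [Module K V] : DGModule K where
  carrier := Cell → V
  grade := cochainGrade K V
  internal := isInternal_of_proj _ (cochainProj K V) cochainProj_mem cochainProj_id
    cochainProj_ne cochainProj_sum
  d := cochainD K V
  d_mem := cochainD_mem
  d_d := cochainD_cochainD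

/-- The complex `C*(Δ₁, X; V)` of relative cochains. -/
def relCochains (K : Type u) [Field K] (V : Type u) [AddCommGroup V] [Module K V]
    (X : ClosedSub) : DGModule K where
  carrier := vanishing K V X.cells
  grade n := (cochainGrade K V n).comap (vanishing K V X.cells).subtype
  internal := isInternal_of_proj _
    (fun n => (cochainProj K V n).restrict (p := vanishing K V X.cells)
      (q := vanishing K V X.cells) fun f hf c hc => by simp [cochainProj, hf c hc])
    (fun n f => cochainProj_mem (K := K) n f.1)
    (fun n f hf => Subtype.ext (cochainProj_id (K := K) n f.1 hf))
    (fun m n h f hf => Subtype.ext (cochainProj_ne (K := K) m n h f.1 hf))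
    (fun f => Subtype.ext (cochainProj_sum (K := K) f.1))
  d := (cochainD K V).restrict (p := vanishing K V X.cells) (q := vanishing K V X.cells) (by
    intro f hf c hc
    cases c with
    | left => rfl
    | right => rfl
    | edge =>
      have h := X.closed hc
      simp [cochainD, hf _ h.1, hf _ h.2])
  d_mem n a ha := cochainD_mem (K := K) (V := V) n a.1 ha
  d_d a := Subtype.ext (cochainD_cochainD (K := K) a.1)

variable {V W : Type u} [AddCommGroup V] [Module K V] [AddCommGroup W] [Module K W]

/-- The map of cochain complexes induced by a linear map of coefficients. -/
def cochainsMap (f : V →ₗ[K] W) : (cochains K V).carrier →ₗ[K] (cochains K W).carrier :=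
  f.compLeft Cell

/-- The map of relative cochain complexes induced by a linear map of coefficients. -/
def relCochainsMap (X : ClosedSub) (f : V →ₗ[K] W) :
    (relCochains K V X).carrier →ₗ[K] (relCochains K W X).carrier :=
  show vanishing K V X.cells →ₗ[K] vanishing K W X.cells from
  (f.compLeft Cell).restrict (p := vanishing K V X.cells) (q := vanishing K W X.cells)
    fun g hg c hc => by simp [hg c hc]

/-- The `0`-cochain with value `x` on the right vertex and `0` on the left one. -/
def rightCochain (x : V) : Cell → V
  | .left => 0
  | .right => x
  | .edge => 0

end Cochains

/-! ## The three types of algebras -/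

section Types

/-- A local dg `O`-algebra structure on `C*(Δ₁; V)`: the relative cochains of every closed subset
form a dg ideal. -/
@[ext]
structure LocalDGAlg (O : QuadOperad K) (V : Type u) [AddCommGroup V] [Module K V] where
  alg : DGAlg O (cochains K V)
  isLocal : ∀ X : ClosedSub, alg.IsIdeal (vanishing K V X.cells)

/-- The products on `V` of the associated `O`-algebra of a local dg `O`-algebra structure on
`C*(Δ₁; V)`: the product of two `0`-cochains supported on the right vertex is again supported
there, and one takes its value. -/
def LocalDGAlg.assoc {O : QuadOperad K} {V : Type u} [AddCommGroup V] [Module K V]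
    (a : LocalDGAlg O V) (μ : O.E) (x y : V) : V :=
  (a.alg.mul μ (rightCochain x) (rightCochain y) : Cell → V) Cell.right

/-- The local dg `O`-algebra structures on `C*(Δ₁; V)` with trivial associated `O`-algebra. -/
@[ext]
structure TrivialLocalDGAlg (O : QuadOperad K) (V : Type u) [AddCommGroup V] [Module K V] where
  toLocal : LocalDGAlg O V
  assoc_eq_zero : ∀ (μ : O.E) (x y : V), toLocal.assoc μ x y = 0

/-- The restriction of a local dg structure along a morphism of operads. -/
def LocalDGAlg.restrict {O P : QuadOperad K} {V : Type u} [AddCommGroup V] [Module K V]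
    (φ : O ⟶ P) (a : LocalDGAlg P V) : LocalDGAlg O V where
  alg := a.alg.restrict φ
  isLocal X := ⟨(a.isLocal X).1, fun μ => (a.isLocal X).2 (QuadOperad.Hom.map φ μ)⟩

/-- The restriction of a local dg structure with trivial associated algebra. -/
def TrivialLocalDGAlg.restrict {O P : QuadOperad K} {V : Type u} [AddCommGroup V] [Module K V]
    (φ : O ⟶ P) (a : TrivialLocalDGAlg P V) : TrivialLocalDGAlg O V where
  toLocal := a.toLocal.restrict φ
  assoc_eq_zero μ := a.assoc_eq_zero (QuadOperad.Hom.map φ μ)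

/-- A type of algebras depending on an operad `O`: the set of structures on each vector space, the
linear maps which are morphisms, and the restriction of structures along morphisms of `O`. -/
structure AlgType (K : Type u) [Field K] where
  Str : QuadOperad K → (V : Type u) → [AddCommGroup V] → [Module K V] → Type u
  IsHom : ∀ {O : QuadOperad K} {V W : Type u} [AddCommGroup V] [Module K V] [AddCommGroup W]
    [Module K W], Str O V → Str O W → (V →ₗ[K] W) → Prop
  restrict : ∀ {O P : QuadOperad K} {V : Type u} [AddCommGroup V] [Module K V],
    (O ⟶ P) → Str P V → Str O V

/-- The type of algebras defining `Ass_•`: local dg `O`-algebra structures on `C*(Δ₁; V)`. -/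
def assBullet (K : Type u) [Field K] : AlgType K where
  Str O V _ _ := LocalDGAlg O V
  IsHom a b f := a.alg.IsHom b.alg (cochainsMap f)
  restrict φ a := a.restrict φ

/-- The type of algebras defining `Com_•`: local dg `O`-algebra structures on `C*(Δ₁; V)` with
trivial associated `O`-algebra. -/
def comBullet (K : Type u) [Field K] : AlgType K where
  Str O V _ _ := TrivialLocalDGAlg O V
  IsHom a b f := a.toLocal.alg.IsHom b.toLocal.alg (cochainsMap f)
  restrict φ a := a.restrict φ

/-- The type of algebras defining `preLie_•`: dg `O`-algebra structures on the relative cochains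
`C*(Δ₁, v_l; V)`. -/
def preLieBullet (K : Type u) [Field K] : AlgType K where
  Str O V _ _ := DGAlg O (relCochains K V ClosedSub.leftVertex)
  IsHom a b f := a.IsHom b (relCochainsMap ClosedSub.leftVertex f)
  restrict φ a := a.restrict φ

/-- An identification of the algebras over the operads `T.obj O` with the algebras of type `τ`:
a bijection between the structures on each vector space `V`, preserving and reflecting morphisms,
and natural in `O`.  Thus `T` is the endofunctor of the category of operads which sends `O` to
the operad whose algebras are those of type `τ`. -/
structure Represents (T : QuadOperad K ⥤ QuadOperad K) (τ : AlgType K) where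
  equiv : ∀ (O : QuadOperad K) (V : Type u) [AddCommGroup V] [Module K V],
    Alg (T.obj O) V ≃ τ.Str O V
  isHom_iff : ∀ (O : QuadOperad K) (V W : Type u) [AddCommGroup V] [Module K V] [AddCommGroup W]
    [Module K W] (a : Alg (T.obj O) V) (b : Alg (T.obj O) W) (f : V →ₗ[K] W),
    a.IsHom b f ↔ τ.IsHom (equiv O V a) (equiv O W b) f
  natural : ∀ {O P : QuadOperad K} (φ : O ⟶ P) (V : Type u) [AddCommGroup V] [Module K V]
    (a : Alg (T.obj P) V), equiv O V (a.restrict (T.map φ)) = τ.restrict φ (equiv P V a)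

end Types

end BQ

/-! Two independent facts are combined: a functor `T` is determined up to natural isomorphism by the
type of algebras that it represents (`Represents.iso`), and each of the three black products
represents the required type.

Reconstruction. Two representations of the same type give, for each `O`, mutually inverse functors
between the algebras over the two operads, compatible with the underlying spaces. Such a functor
need not come from a morphism of operads: over a field with q elements, (x, y) ↦ x^q y is a natural
bilinear product on commutative algebras. Its leading term is better behaved. It is read off on
`pairAlg`, the free algebra on two generators modulo all monomials with a repeated generator, and is
an equivariant map of binary operations. The analogous `tripleAlg` on three generators has `Free3`
modulo the relations as its top part, so it detects that leading terms respect relations. Leading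
terms of inverse functors are inverse to each other, and they are natural.

Representation. An algebra over the black product of `O` with `Ass` or `PreLie` amounts to one
family of products `L` without symmetry, the opposite generator acting by the negative of `oppMul O
L`. On cochains, `L` is the product of a 1-cochain with a 0-cochain on the right vertex. Degree,
symmetry, the Leibniz rule and, on the full interval, locality determine every other product from
`L` (`LocalDGAlg.cmul_eq`, `DGAlg.rmul_eq`). The relations of `O` on cochains supported on (left,
edge, right) become the two-term relation of `Ass`; if the left vertex is absent, only (edge, right,
right) remains, which gives the four-term relation of `PreLie`. Conversely, each of these relations
makes the full sums of ternary products vanish (`AssRel.nest_cochainMul`,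
`PreLieRel.nest_cochainMul`). The associated algebra has the products `L + oppMul O L`, so it is
trivial exactly when `oppMul O L = -L`, and this turns the relation of `Ass` into that of `Com`. -/

namespace BQ

/-! ### Recovering a quadratic operad from its algebras -/

section Reconstruction

variable {K : Type u} [Field K]

theorem nest_zero_of_forall {E A : Type u} [AddCommGroup E] [Module K E] [AddCommGroup A]
    [Module K A] (m : E →ₗ[K] A →ₗ[K] A →ₗ[K] A) (t : E ⊗[K] E) (x y z : A)
    (h : ∀ μ ν, m μ (m ν x y) z = 0) : nest m t x y z = 0 := by
  induction t using TensorProduct.induction_on with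
  | zero => simp [nest]
  | tmul a b => simp [nest, h]
  | add a b ha hb => simp only [nest, map_add] at ha hb ⊢; rw [ha, hb, add_zero]

/-- A functor from `P`-algebras to `Q`-algebras that does not change the underlying spaces. -/
structure AlgFunctor (P Q : QuadOperad K) where
  obj : ∀ {V : Type u} [AddCommGroup V] [Module K V], Alg P V → Alg Q V
  isHom : ∀ {V W : Type u} [AddCommGroup V] [Module K V] [AddCommGroup W] [Module K W]
    {a : Alg P V} {b : Alg P W} {f : V →ₗ[K] W}, a.IsHom b f → (obj a).IsHom (obj b) f

/-- The products of the multilinear part of the free `P`-algebra on two generators. -/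
def pairMul (P : QuadOperad K) :
    P.E →ₗ[K] (K × K × P.E) →ₗ[K] (K × K × P.E) →ₗ[K] (K × K × P.E) where
  toFun μ := LinearMap.mk₂ K
    (fun v w => (0, 0, (v.1 * w.2.1) • μ + (v.2.1 * w.1) • P.swap μ))
    (fun v v' w => by ext <;> simp; module)
    (fun c v w => by ext <;> simp; module)
    (fun v w w' => by ext <;> simp; module)
    (fun c v w => by ext <;> simp; module)
  map_add' μ ν := by
    refine LinearMap.ext₂ fun v w => ?_
    ext <;> simp; module
  map_smul' c μ := by
    refine LinearMap.ext₂ fun v w => ?_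
    ext <;> simp; module

theorem pairMul_apply (P : QuadOperad K) (μ : P.E) (v w : K × K × P.E) :
    pairMul P μ v w = (0, 0, (v.1 * w.2.1) • μ + (v.2.1 * w.1) • P.swap μ) := rfl

/-- The multilinear part of the free `P`-algebra on two generators. -/
def pairAlg (P : QuadOperad K) : Alg P (K × K × P.E) where
  mul := pairMul P
  mul_swap μ v w := by
    simp only [pairMul_apply, P.swap_swap]
    ext <;> simp
    rw [add_comm, mul_comm v.2.1, mul_comm v.1]
  rel r _ x y z := by
    have h : ∀ (t : P.E ⊗[K] P.E) (x y z : K × K × P.E), nest (pairMul P) t x y z = 0 :=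
      fun t x y z => nest_zero_of_forall _ _ _ _ _ fun μ ν => by simp [pairMul_apply]
    simp only [h, add_zero]

theorem pairAlg_mul (P : QuadOperad K) (μ : P.E) (v w : K × K × P.E) :
    (pairAlg P).mul μ v w = (0, 0, (v.1 * w.2.1) • μ + (v.2.1 * w.1) • P.swap μ) := rfl

/-- The linear map from `pairAlg P` with prescribed values. -/
def pairLift {E V : Type u} [AddCommGroup E] [Module K E] [AddCommGroup V] [Module K V] (v w : V)
    (g : E →ₗ[K] V) : (K × K × E) →ₗ[K] V :=
  (LinearMap.toSpanSingleton K V v).coprod ((LinearMap.toSpanSingleton K V w).coprod g)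

theorem pairLift_apply {E V : Type u} [AddCommGroup E] [Module K E] [AddCommGroup V] [Module K V]
    (v w : V) (g : E →ₗ[K] V) (z : K × K × E) :
    pairLift v w g z = z.1 • v + (z.2.1 • w + g z.2.2) := rfl

variable {P Q : QuadOperad K} {V W : Type u} [AddCommGroup V] [Module K V] [AddCommGroup W]
  [Module K W]

theorem Alg.mul_zero_symm (a : Alg P V) {v w : V} (h : ∀ μ, a.mul μ v w = 0) (μ : P.E) :
    a.mul μ w v = 0 := by
  rw [← a.mul_swap, h]

/-- `pairAlg P` is universal among pairs of elements all of whose products vanish, except those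
between the two elements. The products in the reverse order are controlled by `mul_swap`, so one
order suffices in the hypotheses. -/
theorem pairLift_isHom (a : Alg P V) {v w : V} {g : P.E →ₗ[K] V} (hv : ∀ μ, a.mul μ v v = 0)
    (hw : ∀ μ, a.mul μ w w = 0) (hvw : ∀ μ, a.mul μ v w = g μ)
    (hvg : ∀ μ e, a.mul μ v (g e) = 0) (hwg : ∀ μ e, a.mul μ w (g e) = 0)
    (hgg : ∀ μ e e', a.mul μ (g e) (g e') = 0) : (pairAlg P).IsHom a (pairLift v w g) := by
  intro μ x y
  have hwv : a.mul μ w v = g (P.swap μ) := by rw [← hvw, a.mul_swap]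
  have hgv : ∀ e, a.mul μ (g e) v = 0 := fun e => a.mul_zero_symm (fun μ => hvg μ e) μ
  have hgw : ∀ e, a.mul μ (g e) w = 0 := fun e => a.mul_zero_symm (fun μ => hwg μ e) μ
  simp only [pairLift_apply, pairAlg_mul, map_add, map_smul, LinearMap.add_apply,
    LinearMap.smul_apply, hv, hw, hvw, hwv, hgv, hgw, hvg, hwg, hgg]
  module

namespace AlgFunctor

variable (F : AlgFunctor P Q)

/-- The bilinear operation of `F.obj`, to leading order. -/
def leadingMap : Q.E →ₗ[K] P.E where
  toFun q := ((F.obj (pairAlg P)).mul q (1, 0, 0) (0, 1, 0)).2.2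
  map_add' q q' := by simp
  map_smul' c q := by simp

theorem mul_pair (q : Q.E) :
    (F.obj (pairAlg P)).mul q (1, 0, 0) (0, 1, 0) = (0, 0, F.leadingMap q) := by
  -- The endomorphisms that kill one generator and all products remain morphisms after `F`. They
  -- send the product of the two generators to a product with a zero factor, so this product has no
  -- component along a generator.
  have h1 : (pairAlg P).IsHom (pairAlg P) (pairLift (1, 0, 0) 0 0) :=
    pairLift_isHom _ (by simp [pairAlg_mul]) (by simp) (by simp) (by simp) (by simp) (by simp)
  have h2 : (pairAlg P).IsHom (pairAlg P) (pairLift 0 (0, 1, 0) 0) :=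
    pairLift_isHom _ (by simp) (by simp [pairAlg_mul]) (by simp) (by simp) (by simp) (by simp)
  have e1 := F.isHom h1 q (1, 0, 0) (0, 1, 0)
  have e2 := F.isHom h2 q (1, 0, 0) (0, 1, 0)
  simp only [pairLift_apply] at e1 e2
  ext
  · simpa using congrArg Prod.fst e1
  · simpa using congrArg (fun z => z.2.1) e2
  · rfl

/-- Every value of the leading term elsewhere is obtained from this transport of the universal case:
on a pair of elements as in `pairLift_isHom`, higher-order terms cannot contribute. -/
theorem mul_eq_of_isHom {a : Alg P V} {v w : V} {g : P.E →ₗ[K] V}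
    (h : (pairAlg P).IsHom a (pairLift v w g)) (q : Q.E) :
    (F.obj a).mul q v w = g (F.leadingMap q) := by
  have e := F.isHom h q (1, 0, 0) (0, 1, 0)
  rw [mul_pair] at e
  simpa [pairLift_apply] using e.symm

/-- The exchange of the two generators is an automorphism of `pairAlg P` acting on products by
`P.swap`. -/
theorem leadingMap_swap (q : Q.E) : F.leadingMap (Q.swap q) = P.swap (F.leadingMap q) := by
  have h : (pairAlg P).IsHom (pairAlg P)
      (pairLift (0, 1, 0) (1, 0, 0) (LinearMap.inr K K _ ∘ₗ LinearMap.inr K K _ ∘ₗ P.swap)) :=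
    pairLift_isHom _ (by simp [pairAlg_mul]) (by simp [pairAlg_mul]) (by simp [pairAlg_mul])
      (by simp [pairAlg_mul]) (by simp [pairAlg_mul]) (by simp [pairAlg_mul])
  have e := F.mul_eq_of_isHom h q
  rw [← (F.obj (pairAlg P)).mul_swap, mul_pair] at e
  exact congrArg (fun z => z.2.2) e

end AlgFunctor

/-! ### The algebra on three generators, and leading terms as morphisms of operads -/

theorem permute_addRight {E : Type u} [AddCommGroup E] [Module K E] (s : E →ₗ[K] E) (c : Fin 3)
    (t : Free3 K E) (k : Fin 3) : permute s (Equiv.addRight c) t k = t (k - c) := by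
  have h : ∀ c : Fin 3, Equiv.Perm.sign (Equiv.addRight c) = 1 := by decide
  have h' : ∀ c k : Fin 3, (Equiv.addRight c)⁻¹ k = k - c := by decide
  simp only [permute, LinearMap.coe_mk, AddHom.coe_mk, h, h', if_true]

theorem permute_subLeft {E : Type u} [AddCommGroup E] [Module K E] (s : E →ₗ[K] E) (c : Fin 3)
    (t : Free3 K E) (k : Fin 3) :
    permute s (Equiv.subLeft c) t k = TensorProduct.map LinearMap.id s (t (c - k - 1)) := by
  have h : ∀ c : Fin 3, Equiv.Perm.sign (Equiv.subLeft c) ≠ 1 := by decide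
  have h' : ∀ c k : Fin 3, (Equiv.subLeft c)⁻¹ k = c - k := by decide
  simp only [permute, LinearMap.coe_mk, AddHom.coe_mk, h, h', if_false]

/-- The space underlying the multilinear part of the free `P`-algebra on three generators. -/
abbrev Triple (P : QuadOperad K) : Type u :=
  (Fin 3 → K) × (Fin 3 → P.E) × (Free3 K P.E ⧸ P.R)

/-- The products of the multilinear part of the free `P`-algebra on three generators. -/
def tripleMul (P : QuadOperad K) : P.E →ₗ[K] Triple P →ₗ[K] Triple P →ₗ[K] Triple P where
  toFun μ := LinearMap.mk₂ K
    (fun v w => (0, fun k => (v.1 k * w.1 (k + 1)) • μ + (v.1 (k + 1) * w.1 k) • P.swap μ,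
      P.R.mkQ fun k => w.1 (k + 2) • (μ ⊗ₜ v.2.1 k) + v.1 (k + 2) • (P.swap μ ⊗ₜ w.2.1 k)))
    (fun v v' w => by
      refine Prod.ext (by simp) (Prod.ext (funext fun k => ?_) ?_)
      · simp; module
      · simp only [Prod.snd_add, Prod.fst_add, ← map_add]
        congr 1; funext k; simp [TensorProduct.tmul_add]; module)
    (fun c v w => by
      refine Prod.ext (by simp) (Prod.ext (funext fun k => ?_) ?_)
      · simp; module
      · simp only [Prod.smul_snd, Prod.smul_fst, ← map_smul]
        congr 1; funext k; simp; module)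
    (fun v w w' => by
      refine Prod.ext (by simp) (Prod.ext (funext fun k => ?_) ?_)
      · simp; module
      · simp only [Prod.snd_add, Prod.fst_add, ← map_add]
        congr 1; funext k; simp [TensorProduct.tmul_add]; module)
    (fun c v w => by
      refine Prod.ext (by simp) (Prod.ext (funext fun k => ?_) ?_)
      · simp; module
      · simp only [Prod.smul_snd, Prod.smul_fst, ← map_smul]
        congr 1; funext k; simp; module)
  map_add' μ ν := by
    refine LinearMap.ext₂ fun v w => ?_
    refine Prod.ext (by simp) (Prod.ext (funext fun k => ?_) ?_)
    · simp; module
    · simp only [LinearMap.mk₂_apply, LinearMap.add_apply, Prod.snd_add, ← map_add]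
      congr 1; funext k; simp [TensorProduct.add_tmul]; module
  map_smul' c μ := by
    refine LinearMap.ext₂ fun v w => ?_
    refine Prod.ext (by simp) (Prod.ext (funext fun k => ?_) ?_)
    · simp; module
    · simp only [LinearMap.mk₂_apply, LinearMap.smul_apply, Prod.smul_snd, ← map_smul,
        RingHom.id_apply]
      congr 1; funext k; simp [← TensorProduct.smul_tmul']; module

theorem tripleMul_apply (P : QuadOperad K) (μ : P.E) (v w : Triple P) :
    tripleMul P μ v w =
      (0, fun k => (v.1 k * w.1 (k + 1)) • μ + (v.1 (k + 1) * w.1 k) • P.swap μ,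
      P.R.mkQ fun k => w.1 (k + 2) • (μ ⊗ₜ v.2.1 k) + v.1 (k + 2) • (P.swap μ ⊗ₜ w.2.1 k)) := rfl

/-- The two factors of the inner product can supply the generators `k` and `k + 1` in either order,
and the reverse order replaces the inner operation by its opposite. The outer factor must supply the
generator `k + 2`. -/
theorem nest_tripleMul (P : QuadOperad K) (t : P.E ⊗[K] P.E) (x y z : Triple P) :
    nest (tripleMul P) t x y z = (0, 0, P.R.mkQ fun k =>
      (x.1 k * y.1 (k + 1) * z.1 (k + 2)) • t +
      (x.1 (k + 1) * y.1 k * z.1 (k + 2)) • TensorProduct.map LinearMap.id P.swap t) := by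
  induction t using TensorProduct.induction_on with
  | zero =>
    simp only [nest, map_zero, smul_zero, add_zero]
    exact Prod.ext rfl (Prod.ext rfl (map_zero P.R.mkQ).symm)
  | tmul a b =>
    simp only [nest, TensorProduct.lift.tmul, LinearMap.mk₂_apply, tripleMul_apply]
    refine Prod.ext rfl (Prod.ext (by funext k; simp) (congrArg P.R.mkQ (funext fun k => ?_)))
    simp [TensorProduct.tmul_add]; module
  | add a b ha hb =>
    simp only [nest, map_add] at ha hb ⊢
    rw [ha, hb]
    refine Prod.ext (by simp) (Prod.ext (by simp) ?_)
    simp only [Prod.mk_add_mk, ← map_add]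
    congr 1; funext k; simp; module

/-- The multilinear part of the free `P`-algebra on three generators. -/
def tripleAlg (P : QuadOperad K) : Alg P (Triple P) where
  mul := tripleMul P
  mul_swap μ v w := by
    simp only [tripleMul_apply, P.swap_swap]
    refine Prod.ext rfl (Prod.ext (funext fun k => ?_) ?_)
    · simp only []; module
    · simp only []; congr 1; funext k; module
  rel r hr x y z := by
    simp only [nest_tripleMul, Prod.mk_add_mk, add_zero, ← map_add]
    refine Prod.ext rfl (Prod.ext rfl ?_)
    refine (Submodule.Quotient.mk_eq_zero _).2 ?_
    -- The value of a relation at `x, y, z` is a sum over the six ways to assign the generators to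
    -- the arguments. The three rotations and three reflections of `r` carry the corresponding
    -- coefficients, and each lies in `P.R`.
    have key : ((∑ c : Fin 3, (x.1 (0 + c) * y.1 (1 + c) * z.1 (2 + c)) •
          permute P.swap (Equiv.addRight c) r) +
        ∑ c : Fin 3, (x.1 (c - 0) * y.1 (c - 1) * z.1 (c - 2)) •
          permute P.swap (Equiv.subLeft c) r) ∈ P.R :=
      P.R.add_mem (P.R.sum_mem fun c _ => P.R.smul_mem _ (P.permute_mem _ _ hr))
        (P.R.sum_mem fun c _ => P.R.smul_mem _ (P.permute_mem _ _ hr))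
    convert key using 1
    funext k
    simp only [Pi.add_apply, Pi.smul_apply, permute_addRight, permute_subLeft,
      Fin.sum_univ_three]
    fin_cases k <;> simp [show (2 : Fin 3) + 1 = 0 from rfl, show (2 : Fin 3) + 2 = 1 from rfl,
      show (1 : Fin 3) + 1 = 2 from rfl, show (1 : Fin 3) + 2 = 0 from rfl,
      show (1 : Fin 3) - 2 = 2 from rfl, show (0 : Fin 3) - 1 = 2 from rfl,
      show (0 : Fin 3) - 2 = 1 from rfl, show (2 : Fin 3) - 1 = 1 from rfl] <;> module

theorem tripleAlg_mul (P : QuadOperad K) (μ : P.E) (v w : Triple P) :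
    (tripleAlg P).mul μ v w =
      (0, fun k => (v.1 k * w.1 (k + 1)) • μ + (v.1 (k + 1) * w.1 k) • P.swap μ,
      P.R.mkQ fun k => w.1 (k + 2) • (μ ⊗ₜ v.2.1 k) + v.1 (k + 2) • (P.swap μ ⊗ₜ w.2.1 k)) := rfl

namespace AlgFunctor

variable (F : AlgFunctor P Q)

/-- Two of the generators span, together with their products, a copy of `pairAlg P`, so the
universal computation applies. -/
theorem tripleAlg_mul_generators (q : Q.E) (k : Fin 3) :
    (F.obj (tripleAlg P)).mul q (Pi.single k 1, 0, 0) (Pi.single (k + 1) 1, 0, 0) =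
      (0, Pi.single k (F.leadingMap q), 0) := by
  have h : (pairAlg P).IsHom (tripleAlg P) (pairLift (Pi.single k 1, 0, 0)
      (Pi.single (k + 1) 1, 0, 0)
      (LinearMap.inr K _ _ ∘ₗ LinearMap.inl K _ _ ∘ₗ LinearMap.single K (fun _ => P.E) k)) := by
    have key : ∀ k j : Fin 3, (j = k ↔ j + 1 = k + 1) ∧ (j + 1 = k → j ≠ k) ∧ j + 1 ≠ j ∧
      (j = k → j + 2 ≠ k + 1) ∧ (j = k → j + 2 ≠ k) ∧ (j + 1 = k → j ≠ k + 1) ∧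
      k + 1 + 1 ≠ k := by decide
    apply pairLift_isHom
    all_goals
      intros
      simp only [tripleAlg_mul]
      refine Prod.ext rfl (Prod.ext (funext fun j => ?_)
        ((congrArg P.R.mkQ (funext fun j => ?_)).trans (map_zero P.R.mkQ)))
    all_goals
      obtain ⟨h1, h2, h3, h4, h5, h6, h7⟩ := key k j
      by_cases hj : j = k <;> simp_all [Pi.single_apply]
  exact F.mul_eq_of_isHom h q

/-- The product of two generators and the remaining generator again form a pair as in
`pairLift_isHom`. Together with `tripleAlg_mul_generators` this computes nested products. -/
theorem tripleAlg_mul_product (q : Q.E) (e : P.E) (k : Fin 3) :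
    (F.obj (tripleAlg P)).mul q (0, Pi.single k e, 0) (Pi.single (k + 2) 1, 0, 0) =
      (0, 0, P.R.mkQ (Pi.single k (F.leadingMap q ⊗ₜ e))) := by
  have h : (pairAlg P).IsHom (tripleAlg P) (pairLift (0, Pi.single k e, 0)
      (Pi.single (k + 2) 1, 0, 0)
      (LinearMap.inr K _ _ ∘ₗ LinearMap.inr K _ _ ∘ₗ P.R.mkQ ∘ₗ
        LinearMap.single K (fun _ => P.E ⊗[K] P.E) k ∘ₗ (TensorProduct.mk K P.E P.E).flip e)) := by
    have key : ∀ k j : Fin 3, (j = k ↔ j + 2 = k + 2) ∧ j + 1 ≠ j := by decide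
    apply pairLift_isHom
    case hvw =>
      intro μ
      simp only [tripleAlg_mul]
      refine Prod.ext rfl (Prod.ext (funext fun j => by simp)
        (congrArg P.R.mkQ (funext fun j => ?_)))
      by_cases hj : j = k <;> simp [hj]
    all_goals
      intros
      simp only [tripleAlg_mul]
      refine Prod.ext rfl (Prod.ext (funext fun j => ?_)
        ((congrArg P.R.mkQ (funext fun j => ?_)).trans (map_zero P.R.mkQ)))
    all_goals
      obtain ⟨h1, h2⟩ := key k j
      by_cases hj : j = k + 2 <;> simp_all [Pi.single_apply]
  exact F.mul_eq_of_isHom h q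

theorem nest_generators (t : Q.E ⊗[K] Q.E) (k : Fin 3) :
    nest (F.obj (tripleAlg P)).mul t (Pi.single k 1, 0, 0) (Pi.single (k + 1) 1, 0, 0)
      (Pi.single (k + 2) 1, 0, 0) =
    (0, 0, P.R.mkQ (Pi.single k (TensorProduct.map F.leadingMap F.leadingMap t))) := by
  induction t using TensorProduct.induction_on with
  | zero =>
    simp only [nest, map_zero, Pi.single_zero]
    rfl
  | tmul a b =>
    simp only [nest, TensorProduct.lift.tmul, LinearMap.mk₂_apply, tripleAlg_mul_generators,
      tripleAlg_mul_product, TensorProduct.map_tmul]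
  | add a b ha hb =>
    simp only [nest, map_add, Pi.single_add] at ha hb ⊢
    rw [ha, hb]
    simp

/-- Evaluated at the three generators, `r` gives the class of its image in `Free3 K P.E ⧸ P.R`. This
class is zero because `F.obj (tripleAlg P)` is a `Q`-algebra. -/
theorem map3_leadingMap_mem (r : Free3 K Q.E) (hr : r ∈ Q.R) : map3 F.leadingMap r ∈ P.R := by
  have h := (F.obj (tripleAlg P)).rel r hr (Pi.single 0 1, 0, 0) (Pi.single 1 1, 0, 0)
    (Pi.single 2 1, 0, 0)
  have h0 := F.nest_generators (r 0) 0
  have h1 := F.nest_generators (r 1) 1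
  have h2 := F.nest_generators (r 2) 2
  simp only [show (0 : Fin 3) + 1 = 1 from rfl, show (0 : Fin 3) + 2 = 2 from rfl,
    show (1 : Fin 3) + 1 = 2 from rfl, show (1 : Fin 3) + 2 = 0 from rfl,
    show (2 : Fin 3) + 1 = 0 from rfl, show (2 : Fin 3) + 2 = 1 from rfl] at h0 h1 h2
  rw [h0, h1, h2] at h
  simp only [Prod.mk_add_mk, ← map_add] at h
  have h3 := (Submodule.Quotient.mk_eq_zero P.R).1 (congrArg (fun z => z.2.2) h)
  convert h3 using 1
  funext k
  fin_cases k <;> simp [map3]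

/-- The morphism of operads given by the leading terms of a functor between their algebras. -/
def leading : Q ⟶ P where
  map := F.leadingMap
  map_swap := F.leadingMap_swap
  map_rel := F.map3_leadingMap_mem

theorem mul_pairAlg (q : Q.E) (v w : K × K × P.E) :
    (F.obj (pairAlg P)).mul q v w =
      (0, 0, (v.1 * w.2.1) • F.leadingMap q + (v.2.1 * w.1) • P.swap (F.leadingMap q)) := by
  -- If two elements have only zero products among themselves in the `P`-algebra, then
  -- `pairLift_isHom` applies with `g = 0`, so `F` cannot create a product between them.
  have zero : ∀ v w : K × K × P.E, (∀ μ, (pairAlg P).mul μ v v = 0) →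
      (∀ μ, (pairAlg P).mul μ w w = 0) → (∀ μ, (pairAlg P).mul μ v w = 0) →
      ∀ q, (F.obj (pairAlg P)).mul q v w = 0 := fun v w hv hw hvw q =>
    F.mul_eq_of_isHom (g := 0) (pairLift_isHom _ hv hw hvw (by simp) (by simp) (by simp)) q
  let x : K × K × P.E := (1, 0, 0)
  let y : K × K × P.E := (0, 1, 0)
  let i : P.E → K × K × P.E := fun e => (0, 0, e)
  have hx : ∀ μ, (pairAlg P).mul μ x x = 0 := fun μ => by simp [pairAlg_mul, x]
  have hy : ∀ μ, (pairAlg P).mul μ y y = 0 := fun μ => by simp [pairAlg_mul, y]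
  have hxi : ∀ e μ, (pairAlg P).mul μ x (i e) = 0 := fun e μ => by simp [pairAlg_mul, x, i]
  have hyi : ∀ e μ, (pairAlg P).mul μ y (i e) = 0 := fun e μ => by simp [pairAlg_mul, y, i]
  have hii : ∀ e e' μ, (pairAlg P).mul μ (i e) (i e') = 0 :=
    fun e e' μ => by simp [pairAlg_mul, i]
  have hxy : (F.obj (pairAlg P)).mul q x y = i (F.leadingMap q) := F.mul_pair q
  have hyx : (F.obj (pairAlg P)).mul q y x = i (P.swap (F.leadingMap q)) := by
    rw [← Alg.mul_swap, ← F.leadingMap_swap]; exact F.mul_pair _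
  have dec : ∀ v : K × K × P.E, v = v.1 • x + v.2.1 • y + i v.2.2 := fun v => by
    simp [x, y, i]
  rw [dec v, dec w]
  simp only [map_add, map_smul, LinearMap.add_apply, LinearMap.smul_apply, zero x x hx hx hx q,
    zero y y hy hy hy q, hxy, hyx, zero x _ hx (hii _ _) (hxi _) q,
    zero y _ hy (hii _ _) (hyi _) q, zero _ _ (hii _ _) (hii _ _) (hii _ _) q,
    zero _ x (hii _ _) hx (Alg.mul_zero_symm _ (hxi _)) q,
    zero _ y (hii _ _) hy (Alg.mul_zero_symm _ (hyi _)) q]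
  simp [x, y, i]
  module

/-- By `mul_pairAlg` the products of `F.obj (pairAlg P)` are known completely, so `pairAlg Q` maps
to it by `F.leadingMap` on products. Applying `G` to this morphism computes the original product of
`pairAlg P` as a composite of leading terms. -/
theorem leadingMap_leadingMap (G : AlgFunctor Q P)
    (h : G.obj (F.obj (pairAlg P)) = pairAlg P) (p : P.E) :
    F.leadingMap (G.leadingMap p) = p := by
  have hom : (pairAlg Q).IsHom (F.obj (pairAlg P)) (pairLift (1, 0, 0) (0, 1, 0)
      (LinearMap.inr K K _ ∘ₗ LinearMap.inr K K _ ∘ₗ F.leadingMap)) :=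
    pairLift_isHom _ (by simp [mul_pairAlg]) (by simp [mul_pairAlg]) (by simp [mul_pairAlg])
      (by simp [mul_pairAlg]) (by simp [mul_pairAlg]) (by simp [mul_pairAlg])
  have e := G.mul_eq_of_isHom hom p
  rw [h] at e
  simpa [pairAlg_mul] using (congrArg (fun z => z.2.2) e).symm

/-- The morphism `f` induces a morphism from `pairAlg P` to the restriction of `pairAlg P'`. The
product of the two generators after `F` is then computed in two ways. -/
theorem leading_natural {P' Q' : QuadOperad K} (F' : AlgFunctor P' Q') (f : P ⟶ P') (g : Q ⟶ Q')
    (h : F.obj ((pairAlg P').restrict f) = (F'.obj (pairAlg P')).restrict g) :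
    g ≫ F'.leading = F.leading ≫ f := by
  have hom : (pairAlg P).IsHom ((pairAlg P').restrict f) (pairLift (1, 0, 0) (0, 1, 0)
      (LinearMap.inr K K _ ∘ₗ LinearMap.inr K K _ ∘ₗ QuadOperad.Hom.map f)) :=
    pairLift_isHom _ (by simp [Alg.restrict, pairAlg_mul]) (by simp [Alg.restrict, pairAlg_mul])
      (by simp [Alg.restrict, pairAlg_mul]) (by simp [Alg.restrict, pairAlg_mul])
      (by simp [Alg.restrict, pairAlg_mul]) (by simp [Alg.restrict, pairAlg_mul])
  apply QuadOperad.Hom.ext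
  refine LinearMap.ext fun q => ?_
  have e := F.mul_eq_of_isHom hom q
  rw [h] at e
  have e' : (F'.obj (pairAlg P')).mul (QuadOperad.Hom.map g q) (1, 0, 0) (0, 1, 0) = _ := e
  rw [mul_pair] at e'
  exact congrArg (fun z => z.2.2) e'

end AlgFunctor

/-- The comparison functor between the algebras over two operads with the same algebras. -/
def Represents.algFunctor {T T' : QuadOperad K ⥤ QuadOperad K} {τ : AlgType K}
    (ρ : Represents T τ) (ρ' : Represents T' τ) (O : QuadOperad K) :
    AlgFunctor (T.obj O) (T'.obj O) where
  obj {V} _ _ a := (ρ'.equiv O V).symm (ρ.equiv O V a)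
  isHom {V W} _ _ _ _ {a b f} h := by
    rw [ρ'.isHom_iff, Equiv.apply_symm_apply, Equiv.apply_symm_apply, ← ρ.isHom_iff]
    exact h

/-- A functor is determined up to isomorphism by the type of algebras that it represents. -/
def Represents.iso {T T' : QuadOperad K ⥤ QuadOperad K} {τ : AlgType K}
    (ρ : Represents T τ) (ρ' : Represents T' τ) : T ≅ T' :=
  NatIso.ofComponents
    (fun O =>
      -- Passing from algebras to operads is contravariant, so the forward morphism comes from the
      -- backward comparison functor.
      { hom := (ρ'.algFunctor ρ O).leading
        inv := (ρ.algFunctor ρ' O).leading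
        hom_inv_id := QuadOperad.Hom.ext <| LinearMap.ext fun p =>
          (ρ.algFunctor ρ' O).leadingMap_leadingMap (ρ'.algFunctor ρ O)
            (by simp [Represents.algFunctor]) p
        inv_hom_id := QuadOperad.Hom.ext <| LinearMap.ext fun p =>
          (ρ'.algFunctor ρ O).leadingMap_leadingMap (ρ.algFunctor ρ' O)
            (by simp [Represents.algFunctor]) p })
    (fun {O O'} f => (ρ'.algFunctor ρ O).leading_natural (ρ'.algFunctor ρ O') (T'.map f) (T.map f)
      (by
        change (ρ.equiv O _).symm _ = Alg.restrict _ ((ρ.equiv O' _).symm _)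
        rw [Equiv.symm_apply_eq, ρ.natural, ρ'.natural, Equiv.apply_symm_apply]))

end Reconstruction

/-! ### Evaluation of ternary operations, and algebras over black products -/

section HalfProducts

variable {K : Type u} [Field K]

/-- `nest₂ a b x y z (μ ⊗ ν) = a μ (b ν (x, y), z)`. -/
def nest₂ {E A : Type u} [AddCommGroup E] [Module K E] [AddCommGroup A] [Module K A]
    (a b : E →ₗ[K] A →ₗ[K] A →ₗ[K] A) (x y z : A) : E ⊗[K] E →ₗ[K] A :=
  TensorProduct.lift (LinearMap.mk₂ K (fun μ ν => a μ (b ν x y) z)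
    (fun _ _ _ => by simp) (fun _ _ _ => by simp) (fun _ _ _ => by simp)
    (fun _ _ _ => by simp))

section Nest

variable {E F A : Type u} [AddCommGroup E] [Module K E] [AddCommGroup F] [Module K F]
  [AddCommGroup A] [Module K A]

theorem nest₂_tmul (a b : E →ₗ[K] A →ₗ[K] A →ₗ[K] A) (x y z : A) (μ ν : E) :
    nest₂ a b x y z (μ ⊗ₜ ν) = a μ (b ν x y) z := rfl

theorem nest₂_zero_left (a b : E →ₗ[K] A →ₗ[K] A →ₗ[K] A) (y z : A) : nest₂ a b 0 y z = 0 :=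
  TensorProduct.ext' fun _ _ => by simp [nest₂_tmul]

theorem nest₂_zero_middle (a b : E →ₗ[K] A →ₗ[K] A →ₗ[K] A) (x z : A) : nest₂ a b x 0 z = 0 :=
  TensorProduct.ext' fun _ _ => by simp [nest₂_tmul]

theorem nest₂_zero_right (a b : E →ₗ[K] A →ₗ[K] A →ₗ[K] A) (x y : A) : nest₂ a b x y 0 = 0 :=
  TensorProduct.ext' fun _ _ => by simp [nest₂_tmul]

theorem nest_eq_nest₂ (m : E →ₗ[K] A →ₗ[K] A →ₗ[K] A) (t : E ⊗[K] E) (x y z : A) :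
    nest m t x y z = nest₂ m m x y z t := rfl

theorem nest₂_swap {b b' : E →ₗ[K] A →ₗ[K] A →ₗ[K] A} {s : E →ₗ[K] E}
    (hs : ∀ μ x y, b (s μ) x y = b' μ y x) (a : E →ₗ[K] A →ₗ[K] A →ₗ[K] A) (x y z : A)
    (t : E ⊗[K] E) :
    nest₂ a b x y z (TensorProduct.map LinearMap.id s t) = nest₂ a b' y x z t := by
  induction t using TensorProduct.induction_on with
  | zero => simp
  | tmul μ ν => simp [nest₂_tmul, hs]
  | add t t' h h' => rw [map_add, map_add, map_add, h, h']

theorem nest₂_tensorTensorTensorComm (m : E ⊗[K] F →ₗ[K] A →ₗ[K] A →ₗ[K] A) (x y z : A) (u v : E)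
    (t : F ⊗[K] F) :
    nest₂ m m x y z (TensorProduct.tensorTensorTensorComm K E E F F ((u ⊗ₜ v) ⊗ₜ t)) =
      nest₂ (m ∘ₗ TensorProduct.mk K E F u) (m ∘ₗ TensorProduct.mk K E F v) x y z t := by
  induction t using TensorProduct.induction_on with
  | zero => simp
  | tmul μ ν => rfl
  | add t t' h h' => rw [TensorProduct.tmul_add, map_add, map_add, map_add, h, h']

/-- The value at `x 0, x 1, x 2` of a ternary operation. -/
def evalFree3 (m : E →ₗ[K] A →ₗ[K] A →ₗ[K] A) (x : Fin 3 → A) : Free3 K E →ₗ[K] A :=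
  ∑ k : Fin 3, nest₂ m m (x k) (x (k + 1)) (x (k + 2)) ∘ₗ LinearMap.proj k

theorem evalFree3_apply (m : E →ₗ[K] A →ₗ[K] A →ₗ[K] A) (x : Fin 3 → A) (r : Free3 K E) :
    evalFree3 m x r = ∑ k : Fin 3, nest₂ m m (x k) (x (k + 1)) (x (k + 2)) (r k) := by
  simp [evalFree3]

theorem evalFree3_eq_nest (m : E →ₗ[K] A →ₗ[K] A →ₗ[K] A) (x : Fin 3 → A) (r : Free3 K E) :
    evalFree3 m x r = nest m (r 0) (x 0) (x 1) (x 2) + nest m (r 1) (x 1) (x 2) (x 0) +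
      nest m (r 2) (x 2) (x 0) (x 1) := by
  rw [evalFree3_apply, Fin.sum_univ_three]
  rfl

/-- Both sides have the same three summands in a different order. An even permutation commutes with
adding a constant to the index; an odd one reverses the cyclic order, and this is compensated by the
opposite inner operation. -/
theorem evalFree3_permute {m : E →ₗ[K] A →ₗ[K] A →ₗ[K] A} {s : E →ₗ[K] E}
    (hs : ∀ μ x y, m (s μ) x y = m μ y x) (σ : Equiv.Perm (Fin 3)) (x : Fin 3 → A)
    (r : Free3 K E) : evalFree3 m x (permute s σ r) = evalFree3 m (x ∘ σ) r := by
  have even : ∀ (σ : Equiv.Perm (Fin 3)), Equiv.Perm.sign σ = 1 → ∀ k,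
      σ (k + 1) = σ k + 1 ∧ σ (k + 2) = σ k + 2 := by decide
  have odd : ∀ (σ : Equiv.Perm (Fin 3)), Equiv.Perm.sign σ ≠ 1 → ∀ k,
      σ⁻¹ (σ (k + 1)) - 1 = k ∧ σ k = σ (k + 1) + 1 ∧ σ (k + 2) = σ (k + 1) + 2 := by decide
  rw [evalFree3_apply, evalFree3_apply]
  by_cases h : Equiv.Perm.sign σ = 1
  · refine (Fintype.sum_equiv σ _ _ fun k => ?_).symm
    obtain ⟨h1, h2⟩ := even σ h k
    simp [permute, h, h1, h2]
  · refine (Fintype.sum_equiv ((Equiv.addRight 1).trans σ) _ _ fun k => ?_).symm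
    obtain ⟨h1, h2, h3⟩ := odd σ h k
    simp only [permute, h, LinearMap.coe_mk, AddHom.coe_mk, if_false, Equiv.trans_apply,
      Equiv.coe_addRight, h1, nest₂_swap hs, Function.comp_apply]
    rw [h2, h3]

theorem evalFree3_psi_of_two (m : E ⊗[K] F →ₗ[K] A →ₗ[K] A →ₗ[K] A) (x : Fin 3 → A) (p o : E)
    (t : Free3 K F) :
    evalFree3 m x (Psi ![p ⊗ₜ p, -(o ⊗ₜ p), 0] t) =
      nest₂ (m ∘ₗ TensorProduct.mk K E F p) (m ∘ₗ TensorProduct.mk K E F p)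
        (x 0) (x 1) (x 2) (t 0) -
      nest₂ (m ∘ₗ TensorProduct.mk K E F o) (m ∘ₗ TensorProduct.mk K E F p)
        (x 1) (x 2) (x 0) (t 1) := by
  simp [evalFree3_eq_nest, nest_eq_nest₂, psi_apply, TensorProduct.neg_tmul,
    nest₂_tensorTensorTensorComm, sub_eq_add_neg]

theorem evalFree3_psi_of_four (m : E ⊗[K] F →ₗ[K] A →ₗ[K] A →ₗ[K] A) (x : Fin 3 → A) (p o : E)
    (t : Free3 K F) :
    evalFree3 m x (Psi ![p ⊗ₜ p, -(o ⊗ₜ p) + o ⊗ₜ o, -(p ⊗ₜ o)] t) =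
      nest₂ (m ∘ₗ TensorProduct.mk K E F p) (m ∘ₗ TensorProduct.mk K E F p)
        (x 0) (x 1) (x 2) (t 0) +
      (-nest₂ (m ∘ₗ TensorProduct.mk K E F o) (m ∘ₗ TensorProduct.mk K E F p)
        (x 1) (x 2) (x 0) (t 1) +
      nest₂ (m ∘ₗ TensorProduct.mk K E F o) (m ∘ₗ TensorProduct.mk K E F o)
        (x 1) (x 2) (x 0) (t 1)) -
      nest₂ (m ∘ₗ TensorProduct.mk K E F p) (m ∘ₗ TensorProduct.mk K E F o)
        (x 2) (x 0) (x 1) (t 2) := by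
  simp [evalFree3_eq_nest, nest_eq_nest₂, psi_apply, TensorProduct.neg_tmul,
    TensorProduct.add_tmul, nest₂_tensorTensorTensorComm, sub_eq_add_neg]

theorem permute_one (s : E →ₗ[K] E) (r : Free3 K E) : permute s 1 r = r := by
  funext k
  simp [permute]

end Nest

variable {V W : Type u} [AddCommGroup V] [Module K V] [AddCommGroup W] [Module K W]

theorem Alg.evalFree3_eq_zero {O : QuadOperad K} (a : Alg O V) {r : Free3 K O.E} (hr : r ∈ O.R)
    (x : Fin 3 → V) : evalFree3 a.mul x r = 0 := by
  rw [evalFree3_eq_nest]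
  exact a.rel r hr _ _ _

/-- It is enough to test `Psi r t` with `r` a generating relation and `t` arbitrary in `R`, because
the permutations can be moved from `r` to `t` at the cost of a sign. -/
theorem evalFree3_span_psi {E F : Type u} [AddCommGroup E] [Module K E] [AddCommGroup F]
    [Module K F] {s : E →ₗ[K] E} {s' : F →ₗ[K] F} (hs' : ∀ μ, s' (s' μ) = μ)
    {S : Set (Free3 K E)} {R : Submodule K (Free3 K F)}
    (hR : ∀ (σ : Equiv.Perm (Fin 3)) (t : Free3 K F), t ∈ R → permute s' σ t ∈ R)
    (m : E ⊗[K] F →ₗ[K] V →ₗ[K] V →ₗ[K] V)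
    (hm : ∀ w x y, m (-(TensorProduct.map s s' w)) x y = m w y x)
    (hrel : ∀ r ∈ S, ∀ t ∈ R, ∀ x, evalFree3 m x (Psi r t) = 0) (x : Fin 3 → V)
    {w : Free3 K (E ⊗[K] F)}
    (hw : w ∈ Submodule.span K {w | ∃ r ∈ Submodule.span K {t | ∃ (σ : Equiv.Perm (Fin 3))
      (r : Free3 K E), r ∈ S ∧ t = permute s σ r}, ∃ t ∈ R, w = Psi r t}) :
    evalFree3 m x w = 0 := by
  induction hw using Submodule.span_induction with
  | mem w hw =>
    obtain ⟨r, hr, t, ht, rfl⟩ := hw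
    induction hr using Submodule.span_induction with
    | mem r hr =>
      obtain ⟨σ, r, hr, rfl⟩ := hr
      -- Write `t` as `σ` applied to `σ⁻¹ t`. Then `Psi (σ r) t` is, up to sign, `σ` applied to `Psi
      -- r (σ⁻¹ t)`.
      have e := permute_psi s s' σ r (permute s' σ⁻¹ t)
      rw [permute_permute hs', mul_inv_cancel, permute_one] at e
      have e' := evalFree3_permute (m := m) (s := -(TensorProduct.map s s')) hm σ x
        (Psi r (permute s' σ⁻¹ t))
      rw [hrel r hr _ (hR σ⁻¹ t ht)] at e'
      rcases e with e | e
      · rwa [e] at e'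
      · rw [e, map_neg] at e'
        exact neg_eq_zero.1 e'
    | zero => rw [map_zero, LinearMap.zero_apply, map_zero]
    | add a b _ _ ha hb => rw [map_add, LinearMap.add_apply, map_add, ha, hb, add_zero]
    | smul c a _ ha => rw [map_smul, LinearMap.smul_apply, map_smul, ha, smul_zero]
  | zero => exact map_zero _
  | add a b _ _ ha hb => rw [map_add, ha, hb, add_zero]
  | smul c a _ ha => rw [map_smul, ha, smul_zero]

/-- An algebra over a black product `P • O`, where `P` is given by generating relations. -/
def Alg.ofBlackGenerators {E : Type u} [AddCommGroup E] [Module K E] [Module.Finite K E]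
    {s : E →ₗ[K] E} {hs : ∀ μ, s (s μ) = μ} {S : Set (Free3 K E)} {O : QuadOperad K}
    (m : E ⊗[K] O.E →ₗ[K] V →ₗ[K] V →ₗ[K] V)
    (hm : ∀ w x y, m (-(TensorProduct.map s O.swap w)) x y = m w y x)
    (hrel : ∀ r ∈ S, ∀ t ∈ O.R, ∀ x, evalFree3 m x (Psi r t) = 0) :
    Alg (blackProduct (QuadOperad.ofRelations E s hs S) O) V where
  mul := m
  mul_swap := hm
  rel w hw x y z := (evalFree3_eq_nest m ![x, y, z] w).symm.trans
    (evalFree3_span_psi O.swap_swap O.permute_mem m hm hrel _ hw)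

theorem Alg.evalFree3_Psi {E : Type u} [AddCommGroup E] [Module K E] [Module.Finite K E]
    {s : E →ₗ[K] E} {hs : ∀ μ, s (s μ) = μ} {S : Set (Free3 K E)} {O : QuadOperad K}
    (a : Alg (blackProduct (QuadOperad.ofRelations E s hs S) O) V) {r : Free3 K E} (hr : r ∈ S)
    {t : Free3 K O.E} (ht : t ∈ O.R) (x : Fin 3 → V) :
    evalFree3 (E := E ⊗[K] O.E) a.mul x (Psi r t) = 0 := by
  have h1 : r ∈ Submodule.span K {t | ∃ (σ : Equiv.Perm (Fin 3)) (r : Free3 K E),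
      r ∈ S ∧ t = permute s σ r} :=
    Submodule.subset_span ⟨1, r, hr, (permute_one _ _).symm⟩
  have h2 : Psi r t ∈ Submodule.span K {w : Free3 K (E ⊗[K] O.E) | ∃ r ∈ Submodule.span K
      {t | ∃ (σ : Equiv.Perm (Fin 3)) (r : Free3 K E), r ∈ S ∧ t = permute s σ r},
      ∃ t ∈ O.R, w = Psi r t} := Submodule.subset_span ⟨r, h1, t, ht, rfl⟩
  exact a.evalFree3_eq_zero h2 x

/-! ### Black products described by products without symmetry -/

variable {O P : QuadOperad K}

/-- The products opposite to those of `L`. -/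
def oppMul (O : QuadOperad K) (L : O.E →ₗ[K] V →ₗ[K] V →ₗ[K] V) :
    O.E →ₗ[K] V →ₗ[K] V →ₗ[K] V :=
  LinearMap.lflip.toLinearMap ∘ₗ L ∘ₗ O.swap

theorem oppMul_apply (L : O.E →ₗ[K] V →ₗ[K] V →ₗ[K] V) (μ : O.E) (x y : V) :
    oppMul O L μ x y = L (O.swap μ) y x := rfl

theorem oppMul_swap (L : O.E →ₗ[K] V →ₗ[K] V →ₗ[K] V) (μ : O.E) (x y : V) :
    oppMul O L (O.swap μ) x y = L μ y x := by
  rw [oppMul_apply, O.swap_swap]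

/-- The type of algebras given by products without symmetry that satisfy a condition `C`. -/
def halfType (C : ∀ (O : QuadOperad K) {V : Type u} [AddCommGroup V] [Module K V],
      (O.E →ₗ[K] V →ₗ[K] V →ₗ[K] V) → Prop)
    (hC : ∀ {O P : QuadOperad K} {V : Type u} [AddCommGroup V] [Module K V] (φ : O ⟶ P)
      (L : P.E →ₗ[K] V →ₗ[K] V →ₗ[K] V), C P L → C O (L ∘ₗ QuadOperad.Hom.map φ)) :
    AlgType K where
  Str O V _ _ := {L : O.E →ₗ[K] V →ₗ[K] V →ₗ[K] V // C O L}
  IsHom L L' f := ∀ μ x y, f (L.1 μ x y) = L'.1 μ (f x) (f y)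
  restrict φ L := ⟨L.1 ∘ₗ QuadOperad.Hom.map φ, hC φ L.1 L.2⟩

/-- An identification of two types of algebras. -/
structure AlgTypeEquiv (τ τ' : AlgType K) where
  equiv : ∀ (O : QuadOperad K) (V : Type u) [AddCommGroup V] [Module K V],
    τ.Str O V ≃ τ'.Str O V
  isHom_iff : ∀ (O : QuadOperad K) (V W : Type u) [AddCommGroup V] [Module K V] [AddCommGroup W]
    [Module K W] (a : τ.Str O V) (b : τ.Str O W) (f : V →ₗ[K] W),
    τ.IsHom a b f ↔ τ'.IsHom (equiv O V a) (equiv O W b) f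
  natural : ∀ {O P : QuadOperad K} (φ : O ⟶ P) (V : Type u) [AddCommGroup V] [Module K V]
    (a : τ.Str P V), equiv O V (τ.restrict φ a) = τ'.restrict φ (equiv P V a)

/-- Transport of a representation along an identification of types of algebras. -/
def Represents.trans {T : QuadOperad K ⥤ QuadOperad K} {τ τ' : AlgType K} (ρ : Represents T τ)
    (e : AlgTypeEquiv τ τ') : Represents T τ' where
  equiv O V _ _ := (ρ.equiv O V).trans (e.equiv O V)
  isHom_iff O V W _ _ _ _ a b f := (ρ.isHom_iff O V W a b f).trans (e.isHom_iff O V W _ _ f)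
  natural φ V _ _ a := (congrArg (e.equiv _ V) (ρ.natural φ V a)).trans (e.natural φ V _)

/-- The action of `(K × K) ⊗ O(2)` in which a product and its opposite act by `L` and by the
negative of the products opposite to those of `L`. -/
def fromHalf (O : QuadOperad K) (L : O.E →ₗ[K] V →ₗ[K] V →ₗ[K] V) :
    (K × K) ⊗[K] O.E →ₗ[K] V →ₗ[K] V →ₗ[K] V :=
  TensorProduct.lift ((LinearMap.fst K K K).smulRight L + (LinearMap.snd K K K).smulRight
    (-oppMul O L))

theorem fromHalf_tmul (L : O.E →ₗ[K] V →ₗ[K] V →ₗ[K] V) (c : K × K) (μ : O.E) (x y : V) :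
    fromHalf O L (c ⊗ₜ μ) x y = c.1 • L μ x y - c.2 • oppMul O L μ x y := by
  simp [fromHalf, sub_eq_add_neg]

theorem fromHalf_swap (L : O.E →ₗ[K] V →ₗ[K] V →ₗ[K] V) (w : (K × K) ⊗[K] O.E) (x y : V) :
    fromHalf O L (-(TensorProduct.map (flipOp K) O.swap w)) x y = fromHalf O L w y x := by
  induction w using TensorProduct.induction_on with
  | zero => simp
  | tmul c μ =>
    rw [TensorProduct.map_tmul, map_neg, LinearMap.neg_apply, LinearMap.neg_apply, fromHalf_tmul,
      fromHalf_tmul, oppMul_swap, oppMul_apply]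
    simp [flipOp]
  | add a b ha hb =>
    simp only [map_add, neg_add, LinearMap.add_apply, ha, hb]

theorem fromHalf_prodOp (L : O.E →ₗ[K] V →ₗ[K] V →ₗ[K] V) :
    fromHalf O L ∘ₗ TensorProduct.mk K (K × K) O.E (prodOp K) = L := by
  refine LinearMap.ext fun μ => LinearMap.ext₂ fun x y => ?_
  change fromHalf O L (prodOp K ⊗ₜ μ) x y = _
  rw [fromHalf_tmul]
  simp [prodOp]

theorem fromHalf_oppOp (L : O.E →ₗ[K] V →ₗ[K] V →ₗ[K] V) :
    fromHalf O L ∘ₗ TensorProduct.mk K (K × K) O.E (oppOp K) = -oppMul O L := by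
  refine LinearMap.ext fun μ => LinearMap.ext₂ fun x y => ?_
  change fromHalf O L (oppOp K ⊗ₜ μ) x y = _
  rw [fromHalf_tmul]
  simp [oppOp]

/-- The symmetry condition, with the sign from `sgn₂`, expresses the action of `oppOp K ⊗ μ` through
that of `prodOp K ⊗ O.swap μ`. As the two operations form a basis of `K × K`, the action of `prodOp
K` determines everything. -/
theorem fromHalf_comp_prodOp (m : (K × K) ⊗[K] O.E →ₗ[K] V →ₗ[K] V →ₗ[K] V)
    (hm : ∀ w x y, m (-(TensorProduct.map (flipOp K) O.swap w)) x y = m w y x) :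
    fromHalf O (m ∘ₗ TensorProduct.mk K (K × K) O.E (prodOp K)) = m := by
  refine TensorProduct.ext' fun c μ => LinearMap.ext₂ fun x y => ?_
  have h := hm (prodOp K ⊗ₜ O.swap μ) x y
  have hc : c = c.1 • prodOp K + c.2 • oppOp K := by ext <;> simp [prodOp, oppOp]
  rw [TensorProduct.map_tmul, O.swap_swap, show flipOp K (prodOp K) = oppOp K from rfl] at h
  rw [fromHalf_tmul, oppMul_apply]
  conv_rhs => rw [hc]
  simp only [LinearMap.comp_apply, TensorProduct.mk_apply, ← h, TensorProduct.add_tmul,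
    ← TensorProduct.smul_tmul', map_add, map_smul, map_neg, LinearMap.add_apply,
    LinearMap.smul_apply, LinearMap.neg_apply]
  module

theorem isHom_of_prodOp {m : (K × K) ⊗[K] O.E →ₗ[K] V →ₗ[K] V →ₗ[K] V}
    {m' : (K × K) ⊗[K] O.E →ₗ[K] W →ₗ[K] W →ₗ[K] W}
    (hm : ∀ w x y, m (-(TensorProduct.map (flipOp K) O.swap w)) x y = m w y x)
    (hm' : ∀ w x y, m' (-(TensorProduct.map (flipOp K) O.swap w)) x y = m' w y x)
    {f : V →ₗ[K] W}
    (h : ∀ μ x y, f (m (prodOp K ⊗ₜ μ) x y) = m' (prodOp K ⊗ₜ μ) (f x) (f y))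
    (w : (K × K) ⊗[K] O.E) (x y : V) : f (m w x y) = m' w (f x) (f y) := by
  rw [← fromHalf_comp_prodOp m hm, ← fromHalf_comp_prodOp m' hm']
  induction w using TensorProduct.induction_on with
  | zero => simp
  | tmul c μ => simp [fromHalf_tmul, oppMul_apply, h]
  | add w w' e e' => simp only [map_add, LinearMap.add_apply, e, e']

/-- The products without symmetry which give an algebra over the black product with the operad
with relations `S`. -/
def HalfRel (S : Set (Free3 K (K × K))) (O : QuadOperad K) {V : Type u} [AddCommGroup V]
    [Module K V] (L : O.E →ₗ[K] V →ₗ[K] V →ₗ[K] V) : Prop :=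
  ∀ r ∈ S, ∀ t ∈ O.R, ∀ x, evalFree3 (fromHalf O L) x (Psi r t) = 0

theorem oppMul_comp (φ : O ⟶ P) (L : P.E →ₗ[K] V →ₗ[K] V →ₗ[K] V) :
    oppMul O (L ∘ₗ QuadOperad.Hom.map φ) = oppMul P L ∘ₗ QuadOperad.Hom.map φ := by
  refine LinearMap.ext fun μ => LinearMap.ext₂ fun x y => ?_
  change L (QuadOperad.Hom.map φ (O.swap μ)) y x = L (P.swap (QuadOperad.Hom.map φ μ)) y x
  rw [QuadOperad.Hom.map_swap φ]

theorem fromHalf_comp (φ : O ⟶ P) (L : P.E →ₗ[K] V →ₗ[K] V →ₗ[K] V) :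
    fromHalf O (L ∘ₗ QuadOperad.Hom.map φ) =
      fromHalf P L ∘ₗ TensorProduct.map LinearMap.id (QuadOperad.Hom.map φ) := by
  refine TensorProduct.ext' fun c μ => LinearMap.ext₂ fun x y => ?_
  rw [fromHalf_tmul, oppMul_comp]
  exact (fromHalf_tmul (O := P) L c (QuadOperad.Hom.map φ μ) x y).symm

theorem evalFree3_comp {E F : Type u} [AddCommGroup E] [Module K E] [AddCommGroup F] [Module K F]
    (f : E →ₗ[K] F) (m : F →ₗ[K] V →ₗ[K] V →ₗ[K] V) (x : Fin 3 → V) (r : Free3 K E) :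
    evalFree3 (m ∘ₗ f) x r = evalFree3 m x (map3 f r) := by
  rw [evalFree3_eq_nest, evalFree3_eq_nest]
  simp only [map3, LinearMap.coe_mk, AddHom.coe_mk, nest_map]

theorem HalfRel.comp {S : Set (Free3 K (K × K))} (φ : O ⟶ P)
    (L : P.E →ₗ[K] V →ₗ[K] V →ₗ[K] V) (h : HalfRel S P L) :
    HalfRel S O (L ∘ₗ QuadOperad.Hom.map φ) := by
  intro r hr t ht x
  rw [fromHalf_comp, evalFree3_comp, map3_psi, map3_id]
  exact h r hr _ (QuadOperad.Hom.map_rel φ t ht) x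

/-- Algebras over the black product with an operad generated by a product without symmetry. -/
def representsHalf (S : Set (Free3 K (K × K))) :
    Represents (black (QuadOperad.ofRelations (K × K) (flipOp K) (fun _ => rfl) S))
      (halfType (HalfRel S) HalfRel.comp) where
  equiv O V _ _ :=
    { toFun := fun a => ⟨LinearMap.comp (M₂ := (K × K) ⊗[K] O.E) a.mul
          (TensorProduct.mk K (K × K) O.E (prodOp K)), fun r hr t ht x => by
        exact (congrArg (fun m => evalFree3 m x (Psi r t))
          (fromHalf_comp_prodOp _ a.mul_swap)).trans (Alg.evalFree3_Psi a hr ht x)⟩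
      invFun := fun L => Alg.ofBlackGenerators (fromHalf O L.1) (fromHalf_swap L.1) L.2
      left_inv := fun a => Alg.ext (fromHalf_comp_prodOp _ a.mul_swap)
      right_inv := fun L => Subtype.ext (fromHalf_prodOp L.1) }
  isHom_iff O V W _ _ _ _ a b f := by
    exact ⟨fun h μ x y => h (prodOp K ⊗ₜ[K] μ : (K × K) ⊗[K] O.E) x y, fun h w x y =>
      isHom_of_prodOp (O := O) a.mul_swap b.mul_swap h w x y⟩
  natural φ V _ _ a := rfl

/-- The products without symmetry which give an algebra over a black product with `Com`. -/
def ComRel (O : QuadOperad K) {V : Type u} [AddCommGroup V] [Module K V]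
    (L : O.E →ₗ[K] V →ₗ[K] V →ₗ[K] V) : Prop :=
  oppMul O L = -L ∧ ∀ t ∈ O.R, ∀ x : Fin 3 → V,
    nest₂ L L (x 0) (x 1) (x 2) (t 0) - nest₂ L L (x 1) (x 2) (x 0) (t 1) = 0

theorem nest₂_comp {E F : Type u} [AddCommGroup E] [Module K E] [AddCommGroup F] [Module K F]
    (f : E →ₗ[K] F) (m : F →ₗ[K] V →ₗ[K] V →ₗ[K] V) (x y z : V) (t : E ⊗[K] E) :
    nest₂ (m ∘ₗ f) (m ∘ₗ f) x y z t = nest₂ m m x y z (TensorProduct.map f f t) :=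
  (nest_map f m t x y z).symm

theorem ComRel.comp (φ : O ⟶ P) (L : P.E →ₗ[K] V →ₗ[K] V →ₗ[K] V) (h : ComRel P L) :
    ComRel O (L ∘ₗ QuadOperad.Hom.map φ) := by
  refine ⟨?_, fun t ht x => ?_⟩
  · rw [oppMul_comp, h.1]; rfl
  · rw [nest₂_comp, nest₂_comp]
    exact h.2 _ (QuadOperad.Hom.map_rel φ t ht) x

theorem lid_mk (L : O.E →ₗ[K] V →ₗ[K] V →ₗ[K] V) :
    (L ∘ₗ (TensorProduct.lid K O.E).toLinearMap) ∘ₗ TensorProduct.mk K K O.E 1 = L := by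
  refine LinearMap.ext fun μ => ?_
  simp

theorem mk_lid (m : K ⊗[K] O.E →ₗ[K] V →ₗ[K] V →ₗ[K] V) :
    (m ∘ₗ TensorProduct.mk K K O.E 1) ∘ₗ (TensorProduct.lid K O.E).toLinearMap = m := by
  refine TensorProduct.ext' fun c μ => ?_
  simp [TensorProduct.smul_tmul']

/-- Algebras over the black product with `Com`. -/
def representsCom : Represents (black (Com K)) (halfType ComRel ComRel.comp) where
  equiv O V _ _ :=
    { toFun := fun a => ⟨LinearMap.comp (M₂ := K ⊗[K] O.E) a.mul
          (TensorProduct.mk K K O.E 1), by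
        refine ⟨LinearMap.ext fun μ => LinearMap.ext₂ fun x y => ?_, fun t ht x => ?_⟩
        · have h := a.mul_swap ((1 : K) ⊗ₜ[K] μ : K ⊗[K] O.E) y x
          have e := LinearMap.congr_fun₂ (map_neg (F := K ⊗[K] O.E →ₗ[K] V →ₗ[K] V →ₗ[K] V) a.mul
            ((1 : K) ⊗ₜ[K] O.swap μ)) y x
          exact neg_eq_iff_eq_neg.1 (e.symm.trans h)
        · have h := Alg.evalFree3_Psi a (Set.mem_singleton _) ht x
          exact (evalFree3_psi_of_two (E := K) (F := O.E) a.mul x 1 1 t).symm.trans h⟩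
      invFun := fun L => Alg.ofBlackGenerators
        (L.1 ∘ₗ (TensorProduct.lid K O.E).toLinearMap)
        (fun w x y => by
          induction w using TensorProduct.induction_on with
          | zero => simp
          | tmul c μ =>
            have h : ∀ x y, L.1 (O.swap μ) y x = -L.1 μ x y := fun x y =>
              LinearMap.congr_fun₂ (LinearMap.congr_fun L.2.1 μ) x y
            simp [h]
          | add a b ha hb => simp only [map_add, neg_add, LinearMap.add_apply, ha, hb])
        (fun r hr t ht x => by
          rw [Set.mem_singleton_iff.1 hr]
          refine (evalFree3_psi_of_two _ x 1 1 t).trans ?_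
          rw [lid_mk]
          exact L.2.2 t ht x)
      left_inv := fun a => Alg.ext (mk_lid (O := O) a.mul)
      right_inv := fun L => Subtype.ext (lid_mk L.1) }
  isHom_iff O V W _ _ _ _ a b f := by
    refine ⟨fun h μ x y => h ((1 : K) ⊗ₜ[K] μ : K ⊗[K] O.E) x y, fun h w x y => ?_⟩
    have h' : ∀ μ x y, f (a.mul ((1 : K) ⊗ₜ[K] μ : K ⊗[K] O.E) x y) =
      b.mul ((1 : K) ⊗ₜ[K] μ : K ⊗[K] O.E) (f x) (f y) := h
    obtain ⟨μ, rfl⟩ := (TensorProduct.lid K O.E).symm.surjective w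
    exact h' μ x y
  natural φ V _ _ a := rfl

/-- The two minus signs, one from the associativity relation and one from the action of `oppOp K`,
cancel. This is why both terms enter with the sign plus. -/
theorem halfRel_ass_iff (L : O.E →ₗ[K] V →ₗ[K] V →ₗ[K] V) :
    HalfRel {![prodOp K ⊗ₜ prodOp K, -(oppOp K ⊗ₜ prodOp K), 0]} O L ↔
      ∀ t ∈ O.R, ∀ x : Fin 3 → V, nest₂ L L (x 0) (x 1) (x 2) (t 0) +
        nest₂ (oppMul O L) L (x 1) (x 2) (x 0) (t 1) = 0 := by
  have key : ∀ (t : Free3 K O.E) (x : Fin 3 → V), evalFree3 (fromHalf O L) x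
      (Psi ![prodOp K ⊗ₜ prodOp K, -(oppOp K ⊗ₜ prodOp K), 0] t) =
      nest₂ L L (x 0) (x 1) (x 2) (t 0) +
        nest₂ (oppMul O L) L (x 1) (x 2) (x 0) (t 1) := by
    intro t x
    have neg : ∀ x y z : V, nest₂ (-oppMul O L) L x y z = -nest₂ (oppMul O L) L x y z :=
      fun x y z => TensorProduct.ext' fun _ _ => rfl
    refine (evalFree3_psi_of_two _ x (prodOp K) (oppOp K) t).trans ?_
    rw [fromHalf_prodOp, fromHalf_oppOp, neg, LinearMap.neg_apply, sub_neg_eq_add]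
  simp only [HalfRel, Set.mem_singleton_iff, forall_eq, key]

theorem halfRel_preLie_iff (L : O.E →ₗ[K] V →ₗ[K] V →ₗ[K] V) :
    HalfRel {![prodOp K ⊗ₜ prodOp K, -(oppOp K ⊗ₜ prodOp K) + oppOp K ⊗ₜ oppOp K,
      -(prodOp K ⊗ₜ oppOp K)]} O L ↔
      ∀ t ∈ O.R, ∀ x : Fin 3 → V, nest₂ L L (x 0) (x 1) (x 2) (t 0) +
        (nest₂ (oppMul O L) L (x 1) (x 2) (x 0) (t 1) +
          nest₂ (oppMul O L) (oppMul O L) (x 1) (x 2) (x 0) (t 1)) +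
        nest₂ L (oppMul O L) (x 2) (x 0) (x 1) (t 2) = 0 := by
  have key : ∀ (t : Free3 K O.E) (x : Fin 3 → V), evalFree3 (fromHalf O L) x
      (Psi ![prodOp K ⊗ₜ prodOp K, -(oppOp K ⊗ₜ prodOp K) + oppOp K ⊗ₜ oppOp K,
        -(prodOp K ⊗ₜ oppOp K)] t) =
      nest₂ L L (x 0) (x 1) (x 2) (t 0) +
        (nest₂ (oppMul O L) L (x 1) (x 2) (x 0) (t 1) +
          nest₂ (oppMul O L) (oppMul O L) (x 1) (x 2) (x 0) (t 1)) +
        nest₂ L (oppMul O L) (x 2) (x 0) (x 1) (t 2) := by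
    intro t x
    have neg : ∀ x y z : V, nest₂ (-oppMul O L) L x y z = -nest₂ (oppMul O L) L x y z :=
      fun x y z => TensorProduct.ext' fun _ _ => rfl
    have neg' : ∀ x y z : V, nest₂ L (-oppMul O L) x y z = -nest₂ L (oppMul O L) x y z :=
      fun x y z => TensorProduct.ext' fun _ _ => by simp [nest₂_tmul]
    have neg₂ : ∀ x y z : V, nest₂ (-oppMul O L) (-oppMul O L) x y z =
        nest₂ (oppMul O L) (oppMul O L) x y z :=
      fun x y z => TensorProduct.ext' fun _ _ => by simp [nest₂_tmul]
    refine (evalFree3_psi_of_four _ x (prodOp K) (oppOp K) t).trans ?_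
    rw [fromHalf_prodOp, fromHalf_oppOp, neg, neg', neg₂, LinearMap.neg_apply,
      LinearMap.neg_apply, sub_neg_eq_add, neg_neg]
  simp only [HalfRel, Set.mem_singleton_iff, forall_eq, key]

end HalfProducts

/-! ### Products of cochains built from a family of products on coefficients -/

section CochainAlgebras

variable {K : Type u} [Field K] {O P : QuadOperad K}

theorem DGModule.nest_mem {A : DGModule K} {E : Type u} [AddCommGroup E] [Module K E]
    {m : E →ₗ[K] A.carrier →ₗ[K] A.carrier →ₗ[K] A.carrier}
    (hm : ∀ (μ : E) (i j : ℕ), ∀ a ∈ A.grade i, ∀ b ∈ A.grade j, m μ a b ∈ A.grade (i + j))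
    (t : E ⊗[K] E) {i j k : ℕ} {a b c : A.carrier} (ha : a ∈ A.grade i) (hb : b ∈ A.grade j)
    (hc : c ∈ A.grade k) : nest m t a b c ∈ A.grade (i + j + k) := by
  rw [nest_eq_nest₂]
  induction t using TensorProduct.induction_on with
  | zero => simp
  | tmul μ ν => exact hm _ _ _ _ (hm _ _ _ _ ha _ hb) _ hc
  | add t t' h h' => rw [map_add]; exact Submodule.add_mem _ h h'

/-- In a complex concentrated in the degrees `0` and `1` the Koszul signs play no role. -/
def DGAlg.ofUnsigned {A : DGModule K} (hA : ∀ n, 2 ≤ n → ∀ a ∈ A.grade n, a = 0)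
    (m : O.E →ₗ[K] A.carrier →ₗ[K] A.carrier →ₗ[K] A.carrier)
    (mul_mem : ∀ (μ : O.E) (i j : ℕ), ∀ a ∈ A.grade i, ∀ b ∈ A.grade j,
      m μ a b ∈ A.grade (i + j))
    (leibniz : ∀ (μ : O.E) (i : ℕ), ∀ a ∈ A.grade i, ∀ b : A.carrier,
      A.d (m μ a b) = m μ (A.d a) b + (-1 : K) ^ i • m μ a (A.d b))
    (mul_swap : ∀ (μ : O.E) (a b : A.carrier), m (O.swap μ) a b = m μ b a)
    (rel : ∀ r ∈ O.R, ∀ a b c : A.carrier,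
      nest m (r 0) a b c + nest m (r 1) b c a + nest m (r 2) c a b = 0) : DGAlg O A where
  mul := m
  mul_mem := mul_mem
  leibniz := leibniz
  mul_swap μ i j a ha b hb := by
    rw [mul_swap]
    -- A Koszul sign can be nontrivial only if at least two arguments have positive degree. The
    -- product then has degree at least two and vanishes.
    by_cases h : 2 ≤ j + i
    · rw [hA _ h _ (mul_mem μ j i b hb a ha), smul_zero]
    · have h' : i = 0 ∨ j = 0 := by omega
      rcases h' with rfl | rfl <;> simp
  rel r hr i j k a ha b hb c hc := by
    by_cases h : 2 ≤ i + j + k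
    · have e0 := DGModule.nest_mem mul_mem (r 0) ha hb hc
      have e1 := DGModule.nest_mem mul_mem (r 1) hb hc ha
      have e2 := DGModule.nest_mem mul_mem (r 2) hc ha hb
      rw [hA _ h _ e0, hA _ (by omega) _ e1, hA _ (by omega) _ e2]
      simp
    · have h' : (i = 0 ∨ j = 0 ∧ k = 0) ∧ (k = 0 ∨ i = 0 ∧ j = 0) := by omega
      have h1 : i * (j + k) = 0 := by rcases h'.1 with rfl | ⟨rfl, rfl⟩ <;> simp
      have h2 : k * (i + j) = 0 := by rcases h'.2 with rfl | ⟨rfl, rfl⟩ <;> simp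
      rw [h1, h2, pow_zero, one_smul, one_smul]
      exact rel r hr a b c

variable {V W : Type u} [AddCommGroup V] [Module K V] [AddCommGroup W] [Module K W]

/-- The products of cochains determined by the products of `1`-cochains with `0`-cochains
supported on the right vertex. -/
def cochainMul (O : QuadOperad K) (L : O.E →ₗ[K] V →ₗ[K] V →ₗ[K] V) :
    O.E →ₗ[K] (Cell → V) →ₗ[K] (Cell → V) →ₗ[K] (Cell → V) where
  toFun μ := LinearMap.mk₂ K
    (fun f g c => match c with
      | .left => L μ (f .left) (g .left) + oppMul O L μ (f .left) (g .left)
      | .right => L μ (f .right) (g .right) + oppMul O L μ (f .right) (g .right)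
      | .edge => oppMul O L μ (f .right) (g .edge) + L μ (f .edge) (g .right) +
          L μ (f .left) (g .edge) + oppMul O L μ (f .edge) (g .left))
    (fun f f' g => by funext c; cases c <;> simp <;> module)
    (fun k f g => by funext c; cases c <;> simp)
    (fun f g g' => by funext c; cases c <;> simp <;> module)
    (fun k f g => by funext c; cases c <;> simp)
  map_add' μ ν := by
    refine LinearMap.ext₂ fun f g => funext fun c => ?_
    cases c <;> simp <;> module
  map_smul' k μ := by
    refine LinearMap.ext₂ fun f g => funext fun c => ?_
    cases c <;> simp

section Mul

variable (L : O.E →ₗ[K] V →ₗ[K] V →ₗ[K] V) (μ : O.E) (f g : Cell → V)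

theorem cochainMul_left : cochainMul O L μ f g .left =
    L μ (f .left) (g .left) + oppMul O L μ (f .left) (g .left) := rfl

theorem cochainMul_right : cochainMul O L μ f g .right =
    L μ (f .right) (g .right) + oppMul O L μ (f .right) (g .right) := rfl

theorem cochainMul_edge : cochainMul O L μ f g .edge =
    oppMul O L μ (f .right) (g .edge) + L μ (f .edge) (g .right) +
      L μ (f .left) (g .edge) + oppMul O L μ (f .edge) (g .left) := rfl

theorem cochainMul_swap : cochainMul O L (O.swap μ) f g = cochainMul O L μ g f := by
  have h : ∀ x y, L (O.swap μ) x y = oppMul O L μ y x := fun _ _ => rfl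
  funext c
  cases c <;> simp only [cochainMul_left, cochainMul_right, cochainMul_edge, oppMul_swap, h] <;>
    abel

theorem cochainMul_comp (φ : P ⟶ O) :
    cochainMul P (L ∘ₗ QuadOperad.Hom.map φ) = cochainMul O L ∘ₗ QuadOperad.Hom.map φ := by
  refine LinearMap.ext fun μ => LinearMap.ext₂ fun f g => funext fun c => ?_
  cases c <;> simp only [LinearMap.comp_apply, cochainMul_left, cochainMul_right,
    cochainMul_edge, oppMul_comp]

theorem cochainMul_mem_vanishing (X : ClosedSub) (hf : f ∈ vanishing K V X.cells) :
    cochainMul O L μ f g ∈ vanishing K V X.cells := by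
  intro c hc
  have h := hf c hc
  cases c with
  | left => simp [cochainMul_left, h]
  | right => simp [cochainMul_right, h]
  | edge =>
    have hl := hf _ (X.closed hc).1
    have hr := hf _ (X.closed hc).2
    simp [cochainMul_edge, h, hl, hr]

theorem cochainMul_mem_grade {i j : ℕ} (hf : f ∈ cochainGrade K V i)
    (hg : g ∈ cochainGrade K V j) : cochainMul O L μ f g ∈ cochainGrade K V (i + j) := by
  have hf0 : i ≠ 0 → f .left = 0 ∧ f .right = 0 := fun h =>
    ⟨hf .left (Ne.symm h), hf .right (Ne.symm h)⟩
  have hf1 : i ≠ 1 → f .edge = 0 := fun h => hf .edge (Ne.symm h)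
  have hg0 : j ≠ 0 → g .left = 0 ∧ g .right = 0 := fun h =>
    ⟨hg .left (Ne.symm h), hg .right (Ne.symm h)⟩
  have hg1 : j ≠ 1 → g .edge = 0 := fun h => hg .edge (Ne.symm h)
  intro c hc
  have hc' : c.dim ≠ i + j := hc
  by_cases hi : i = 0
  · have hfe := hf1 (by omega)
    by_cases hj : j = 0
    · have hge := hg1 (by omega)
      cases c with
      | left => simp [Cell.dim, hi, hj] at hc'
      | right => simp [Cell.dim, hi, hj] at hc'
      | edge => simp [cochainMul_edge, hfe, hge]
    · obtain ⟨hl, hr⟩ := hg0 hj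
      cases c with
      | left => simp [cochainMul_left, hl]
      | right => simp [cochainMul_right, hr]
      | edge =>
        have hge := hg1 (by simp only [Cell.dim] at hc'; omega)
        simp [cochainMul_edge, hfe, hge]
  · obtain ⟨hl, hr⟩ := hf0 hi
    cases c with
    | left => simp [cochainMul_left, hl]
    | right => simp [cochainMul_right, hr]
    | edge =>
      by_cases hj : j = 0
      · have hge := hg1 (by omega)
        have hfe := hf1 (by simp only [Cell.dim] at hc'; omega)
        simp [cochainMul_edge, hfe, hge]
      · obtain ⟨hl', hr'⟩ := hg0 hj
        simp [cochainMul_edge, hl, hr, hl', hr']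

/-- In degree zero the mixed products of the two vertices cancel, since the products with the edge
at the two ends were chosen to match. For `f` of positive degree every term is zero. -/
theorem cochainMul_leibniz {i : ℕ} (hf : f ∈ cochainGrade K V i) :
    cochainD K V (cochainMul O L μ f g) =
      cochainMul O L μ (cochainD K V f) g +
        (-1 : K) ^ i • cochainMul O L μ f (cochainD K V g) := by
  have dl : ∀ f : Cell → V, cochainD K V f .left = 0 := fun _ => rfl
  have dr : ∀ f : Cell → V, cochainD K V f .right = 0 := fun _ => rfl
  have de : ∀ f : Cell → V, cochainD K V f .edge = f .right - f .left := fun _ => rfl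
  funext c
  cases c with
  | left => simp [dl, cochainMul_left]
  | right => simp [dr, cochainMul_right]
  | edge =>
    simp only [Pi.add_apply, Pi.smul_apply, de, cochainMul_left, cochainMul_right,
      cochainMul_edge, dl, dr, map_sub, map_zero, LinearMap.sub_apply, LinearMap.zero_apply]
    by_cases hi : i = 0
    · subst hi
      module
    · have hl : f .left = 0 := hf .left (Ne.symm hi)
      have hr : f .right = 0 := hf .right (Ne.symm hi)
      simp [hl, hr]

end Mul

section Nest

variable (L : O.E →ₗ[K] V →ₗ[K] V →ₗ[K] V) (t : O.E ⊗[K] O.E) (f g h : Cell → V)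

theorem nest_cochainMul_vertex {c : Cell} (hc : c ≠ .edge) :
    nest (cochainMul O L) t f g h c =
      nest₂ L L (f c) (g c) (h c) t + nest₂ L (oppMul O L) (f c) (g c) (h c) t +
      nest₂ (oppMul O L) L (f c) (g c) (h c) t +
      nest₂ (oppMul O L) (oppMul O L) (f c) (g c) (h c) t := by
  rw [nest_eq_nest₂]
  induction t using TensorProduct.induction_on with
  | zero => simp
  | tmul μ ν =>
    cases c with
    | edge => exact absurd rfl hc
    | left => simp only [nest₂_tmul, cochainMul_left, map_add, LinearMap.add_apply]; abel
    | right => simp only [nest₂_tmul, cochainMul_right, map_add, LinearMap.add_apply]; abel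
  | add t t' e e' => rw [map_add, Pi.add_apply, e, e']; simp only [map_add]; abel

/-- Exactly one argument sits on the edge. For each of its three positions there are four terms: if
it is the outer argument, both inner ones lie on the same vertex and `L + oppMul O L` applies;
otherwise the two vertices are chosen independently. -/
theorem nest_cochainMul_edge :
    nest (cochainMul O L) t f g h .edge =
      nest₂ (oppMul O L) L (f .right) (g .right) (h .edge) t +
      nest₂ (oppMul O L) (oppMul O L) (f .right) (g .right) (h .edge) t +
      nest₂ L L (f .left) (g .left) (h .edge) t +
      nest₂ L (oppMul O L) (f .left) (g .left) (h .edge) t +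
      nest₂ L (oppMul O L) (f .right) (g .edge) (h .right) t +
      nest₂ L L (f .edge) (g .right) (h .right) t +
      nest₂ L L (f .left) (g .edge) (h .right) t +
      nest₂ L (oppMul O L) (f .edge) (g .left) (h .right) t +
      nest₂ (oppMul O L) (oppMul O L) (f .right) (g .edge) (h .left) t +
      nest₂ (oppMul O L) L (f .edge) (g .right) (h .left) t +
      nest₂ (oppMul O L) L (f .left) (g .edge) (h .left) t +
      nest₂ (oppMul O L) (oppMul O L) (f .edge) (g .left) (h .left) t := by
  rw [nest_eq_nest₂]
  induction t using TensorProduct.induction_on with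
  | zero => simp
  | tmul μ ν =>
    simp only [nest₂_tmul, cochainMul_left, cochainMul_right, cochainMul_edge, map_add,
      LinearMap.add_apply]
    abel
  | add t t' e e' => rw [map_add, Pi.add_apply, e, e']; simp only [map_add]; abel

end Nest

/-! ### Relations of the operad on cochains -/

theorem rotate_mem {r : Free3 K O.E} (hr : r ∈ O.R) (c : Fin 3) : (fun k => r (k + c)) ∈ O.R := by
  have h := O.permute_mem (Equiv.addRight (-c)) r hr
  convert h using 1
  funext k
  rw [permute_addRight, sub_neg_eq_add]

theorem reflect_mem {r : Free3 K O.E} (hr : r ∈ O.R) (c : Fin 3) :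
    (fun k => TensorProduct.map LinearMap.id O.swap (r (c - k - 1))) ∈ O.R := by
  have h := O.permute_mem (Equiv.subLeft c) r hr
  convert h using 1
  funext k
  rw [permute_subLeft]

/-- The products which satisfy the relations of the black product with `Ass`. -/
abbrev AssRel (O : QuadOperad K) {V : Type u} [AddCommGroup V] [Module K V]
    (L : O.E →ₗ[K] V →ₗ[K] V →ₗ[K] V) : Prop :=
  HalfRel {![prodOp K ⊗ₜ prodOp K, -(oppOp K ⊗ₜ prodOp K), 0]} O L

/-- The products which satisfy the relations of the black product with `PreLie`. -/
abbrev PreLieRel (O : QuadOperad K) {V : Type u} [AddCommGroup V] [Module K V]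
    (L : O.E →ₗ[K] V →ₗ[K] V →ₗ[K] V) : Prop :=
  HalfRel {![prodOp K ⊗ₜ prodOp K, -(oppOp K ⊗ₜ prodOp K) + oppOp K ⊗ₜ oppOp K,
      -(prodOp K ⊗ₜ oppOp K)]} O L

section Relations

variable {L : O.E →ₗ[K] V →ₗ[K] V →ₗ[K] V}

theorem AssRel.left_assoc (hL : AssRel O L) {r : Free3 K O.E} (hr : r ∈ O.R) (k : Fin 3)
    (x y z : V) : nest₂ L L x y z (r k) + nest₂ (oppMul O L) L y z x (r (k + 1)) = 0 := by
  have h := (halfRel_ass_iff L).1 hL _ (rotate_mem hr k) ![x, y, z]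
  simp only [zero_add] at h
  rw [add_comm k]
  exact h

/-- This is the mirror image of `AssRel.left_assoc`, obtained from a reflected relation. The two
together pair off all four kinds of nested products formed with `L` and `oppMul O L`. -/
theorem AssRel.right_assoc (hL : AssRel O L) {r : Free3 K O.E} (hr : r ∈ O.R) (k : Fin 3)
    (x y z : V) : nest₂ L (oppMul O L) x y z (r k) +
      nest₂ (oppMul O L) (oppMul O L) z x y (r (k + 2)) = 0 := by
  -- With the first two arguments exchanged, the reflection about `k + 1` puts `r k` in first place
  -- and `r (k + 2)` in second place, each with inner operation replaced by its opposite.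
  -- `nest₂_swap` converts this into `oppMul O L` in the inner position.
  have h := (halfRel_ass_iff L).1 hL _ (reflect_mem hr (k + 1)) ![y, x, z]
  simp only [nest₂_swap (b := L) (b' := oppMul O L) (fun _ _ _ => rfl)] at h
  have e0 : ∀ k : Fin 3, k + 1 - 0 - 1 = k := by decide
  have e1 : ∀ k : Fin 3, k + 1 - 1 - 1 = k + 2 := by decide
  rw [e0, e1] at h
  exact h

theorem PreLieRel.rotate (hL : PreLieRel O L) {r : Free3 K O.E} (hr : r ∈ O.R) (k : Fin 3)
    (x y z : V) : nest₂ L L x y z (r k) + (nest₂ (oppMul O L) L y z x (r (k + 1)) +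
      nest₂ (oppMul O L) (oppMul O L) y z x (r (k + 1))) +
      nest₂ L (oppMul O L) z x y (r (k + 2)) = 0 := by
  have h := (halfRel_preLie_iff L).1 hL _ (rotate_mem hr k) ![x, y, z]
  simp only [zero_add] at h
  rw [add_comm k, add_comm k]
  exact h

theorem AssRel.nest_cochainMul (hL : AssRel O L) {r : Free3 K O.E} (hr : r ∈ O.R)
    (f g h : Cell → V) : nest (cochainMul O L) (r 0) f g h + nest (cochainMul O L) (r 1) g h f +
      nest (cochainMul O L) (r 2) h f g = 0 := by
  have l0 := hL.left_assoc hr 0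
  have l1 := hL.left_assoc hr 1
  have l2 := hL.left_assoc hr 2
  have r0 := hL.right_assoc hr 0
  have r1 := hL.right_assoc hr 1
  have r2 := hL.right_assoc hr 2
  simp only [show (0 : Fin 3) + 1 = 1 from rfl, show (0 : Fin 3) + 2 = 2 from rfl,
    show (1 : Fin 3) + 1 = 2 from rfl, show (1 : Fin 3) + 2 = 0 from rfl,
    show (2 : Fin 3) + 1 = 0 from rfl, show (2 : Fin 3) + 2 = 1 from rfl] at l0 l1 l2 r0 r1 r2
  have vertex : ∀ c : Cell, c ≠ .edge → (nest (cochainMul O L) (r 0) f g h +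
      nest (cochainMul O L) (r 1) g h f + nest (cochainMul O L) (r 2) h f g) c = 0 := by
    intro c hc
    simp only [Pi.add_apply, nest_cochainMul_vertex L _ _ _ _ hc]
    -- The twelve nested products at a vertex split into six cancelling pairs.
    linear_combination (norm := module) l0 (f c) (g c) (h c) + l1 (g c) (h c) (f c) +
      l2 (h c) (f c) (g c) + r0 (f c) (g c) (h c) + r1 (g c) (h c) (f c) + r2 (h c) (f c) (g c)
  funext c
  cases c with
  | left => exact vertex _ (by simp)
  | right => exact vertex _ (by simp)
  | edge =>
    simp only [Pi.add_apply, Pi.zero_apply, nest_cochainMul_edge]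
    -- Here 36 nested products split into 18 cancelling pairs. The members of each pair have the
    -- same simplex attached to each of `f`, `g`, `h`, so each two-term identity is used at a fixed
    -- choice of supports.
    linear_combination (norm := module)
      l0 (f .left) (g .left) (h .edge) + l0 (f .edge) (g .right) (h .right) +
      l0 (f .left) (g .edge) (h .right) +
      l1 (g .left) (h .left) (f .edge) + l1 (g .edge) (h .right) (f .right) +
      l1 (g .left) (h .edge) (f .right) +
      l2 (h .left) (f .left) (g .edge) + l2 (h .edge) (f .right) (g .right) +
      l2 (h .left) (f .edge) (g .right) +
      r0 (f .left) (g .left) (h .edge) + r0 (f .right) (g .edge) (h .right) +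
      r0 (f .edge) (g .left) (h .right) +
      r1 (g .left) (h .left) (f .edge) + r1 (g .right) (h .edge) (f .right) +
      r1 (g .edge) (h .left) (f .right) +
      r2 (h .left) (f .left) (g .edge) + r2 (h .right) (f .edge) (g .right) +
      r2 (h .edge) (f .left) (g .right)

/-- Without the left vertex the edge component has only twelve terms, all supported on one edge and
two right vertices. The three rotations of the four-term relation use each of them once; the same
count holds at the right vertex. -/
theorem PreLieRel.nest_cochainMul (hL : PreLieRel O L) {r : Free3 K O.E} (hr : r ∈ O.R)
    {f g h : Cell → V} (hf : f .left = 0) (hg : g .left = 0) (hh : h .left = 0) :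
    nest (cochainMul O L) (r 0) f g h + nest (cochainMul O L) (r 1) g h f +
      nest (cochainMul O L) (r 2) h f g = 0 := by
  have l0 := hL.rotate hr 0
  have l1 := hL.rotate hr 1
  have l2 := hL.rotate hr 2
  simp only [show (0 : Fin 3) + 1 = 1 from rfl, show (0 : Fin 3) + 2 = 2 from rfl,
    show (1 : Fin 3) + 1 = 2 from rfl, show (1 : Fin 3) + 2 = 0 from rfl,
    show (2 : Fin 3) + 1 = 0 from rfl, show (2 : Fin 3) + 2 = 1 from rfl] at l0 l1 l2
  funext c
  cases c with
  | left =>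
    simp only [Pi.add_apply, nest_cochainMul_vertex L _ _ _ _ (show Cell.left ≠ .edge by simp),
      hf, hg, hh, nest₂_zero_left]
    simp
  | right =>
    simp only [Pi.add_apply, Pi.zero_apply,
      nest_cochainMul_vertex L _ _ _ _ (show Cell.right ≠ .edge by simp)]
    linear_combination (norm := module) l0 (f .right) (g .right) (h .right) +
      l1 (g .right) (h .right) (f .right) + l2 (h .right) (f .right) (g .right)
  | edge =>
    simp only [Pi.add_apply, Pi.zero_apply, nest_cochainMul_edge, hf, hg, hh, nest₂_zero_left,
      nest₂_zero_middle, nest₂_zero_right,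
      LinearMap.zero_apply]
    linear_combination (norm := module) l0 (f .edge) (g .right) (h .right) +
      l1 (g .edge) (h .right) (f .right) + l2 (h .edge) (f .right) (g .right)

end Relations

end CochainAlgebras

/-! ### Identification of dg structures on cochains with families of products -/

section Identification

variable {K : Type u} [Field K] {O P : QuadOperad K}
variable {V W : Type u} [AddCommGroup V] [Module K V] [AddCommGroup W] [Module K W]

theorem cochainGrade_eq_zero (n : ℕ) (hn : 2 ≤ n) (f : Cell → V) (hf : f ∈ cochainGrade K V n) :
    f = 0 := by
  funext c
  refine hf c ?_
  cases c <;> simp only [Cell.dim, Set.mem_ofPred_eq] <;> omega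

/-- The cochains supported on one simplex. -/
def cellCochain (K : Type u) [Field K] {V : Type u} [AddCommGroup V] [Module K V] (c : Cell) :
    V →ₗ[K] (Cell → V) :=
  LinearMap.pi fun c' => match c, c' with
    | .left, .left | .right, .right | .edge, .edge => LinearMap.id
    | _, _ => 0

theorem cellCochain_same (c : Cell) (x : V) : cellCochain K c x c = x := by
  cases c <;> rfl

theorem cellCochain_of_ne {c c' : Cell} (h : c ≠ c') (x : V) : cellCochain K c x c' = 0 := by
  cases c <;> cases c' <;> first | rfl | exact absurd rfl h

theorem comp_cellCochain (f : V →ₗ[K] W) (c : Cell) (x : V) :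
    f ∘ cellCochain K c x = cellCochain K c (f x) := by
  funext c'
  by_cases hc : c = c'
  · subst hc
    simp [cellCochain_same]
  · simp [cellCochain_of_ne hc]

theorem cellCochain_mem_grade (c : Cell) (x : V) :
    cellCochain K c x ∈ cochainGrade K V c.dim := by
  intro c' hc'
  refine cellCochain_of_ne ?_ x
  rintro rfl
  exact hc' rfl

theorem eq_sum_cellCochain (f : Cell → V) : f = cellCochain K .left (f .left) +
    cellCochain K .right (f .right) + cellCochain K .edge (f .edge) := by
  funext c
  cases c <;> simp [cellCochain_same, cellCochain_of_ne]

theorem cochainD_cellCochain_left (x : V) :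
    cochainD K V (cellCochain K .left x) = -cellCochain K .edge x := by
  funext c
  cases c <;> simp [cochainD, cellCochain_same, cellCochain_of_ne]

theorem cochainD_cellCochain_right (x : V) :
    cochainD K V (cellCochain K .right x) = cellCochain K .edge x := by
  funext c
  cases c <;> simp [cochainD, cellCochain_same, cellCochain_of_ne]

theorem cochainMul_half (L : O.E →ₗ[K] V →ₗ[K] V →ₗ[K] V) (μ : O.E) (x y : V) :
    cochainMul O L μ (cellCochain K .edge x) (cellCochain K .right y) .edge = L μ x y := by
  simp [cochainMul_edge, cellCochain_same, cellCochain_of_ne]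

theorem cochainMul_map (L : O.E →ₗ[K] V →ₗ[K] V →ₗ[K] V)
    (L' : O.E →ₗ[K] W →ₗ[K] W →ₗ[K] W) (f : V →ₗ[K] W)
    (h : ∀ μ x y, f (L μ x y) = L' μ (f x) (f y)) (μ : O.E) (a b : Cell → V) (c : Cell) :
    f (cochainMul O L μ a b c) = cochainMul O L' μ (f ∘ a) (f ∘ b) c := by
  cases c <;> simp [cochainMul_left, cochainMul_right, cochainMul_edge, oppMul_apply, h]

/-- The products of `1`-cochains with `0`-cochains supported on the right vertex. -/
def halfMul (m : O.E →ₗ[K] (Cell → V) →ₗ[K] (Cell → V) →ₗ[K] (Cell → V)) :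
    O.E →ₗ[K] V →ₗ[K] V →ₗ[K] V where
  toFun μ := ((m μ).compl₁₂ (cellCochain K .edge) (cellCochain K .right)).compr₂
    (LinearMap.proj .edge)
  map_add' μ ν := by refine LinearMap.ext₂ fun x y => ?_; simp
  map_smul' c μ := by refine LinearMap.ext₂ fun x y => ?_; simp

/-! ### Local structures on the full interval -/

section Local

/-- The vertex as a closed subset. -/
def vertexSub (c : Cell) (hc : c ≠ .edge) : ClosedSub :=
  ⟨{c' | c' = c}, fun h => absurd h.symm hc⟩

variable (a : LocalDGAlg O V)

/-- The products of a local dg algebra structure. -/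
def LocalDGAlg.cmul : O.E →ₗ[K] (Cell → V) →ₗ[K] (Cell → V) →ₗ[K] (Cell → V) := a.alg.mul

/-- Locality at a vertex means that the value of a product there depends only on the values of its
factors there. -/
theorem LocalDGAlg.cmul_vertex_left {c : Cell} (hc : c ≠ .edge) (μ : O.E) {f : Cell → V}
    (hf : f c = 0) (g : Cell → V) : a.cmul μ f g c = 0 :=
  ((a.isLocal (vertexSub c hc)).2 μ f (fun _ h => (congrArg f h).trans hf) g).1 c rfl

theorem LocalDGAlg.cmul_vertex_right {c : Cell} (hc : c ≠ .edge) (μ : O.E) (f : Cell → V)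
    {g : Cell → V} (hg : g c = 0) : a.cmul μ f g c = 0 :=
  ((a.isLocal (vertexSub c hc)).2 μ g (fun _ h => (congrArg g h).trans hg) f).2 c rfl

theorem LocalDGAlg.cmul_eq_zero_of_dim {c d e : Cell} (h : e.dim ≠ c.dim + d.dim) (μ : O.E)
    (x y : V) : a.cmul μ (cellCochain K c x) (cellCochain K d y) e = 0 :=
  a.alg.mul_mem μ _ _ _ (cellCochain_mem_grade c x) _ (cellCochain_mem_grade d y) e h

theorem LocalDGAlg.cmul_leibniz (μ : O.E) {f g : Cell → V} (hf : f ∈ cochainGrade K V 0) :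
    a.cmul μ f g .right - a.cmul μ f g .left =
      a.cmul μ (cochainD K V f) g .edge + a.cmul μ f (cochainD K V g) .edge := by
  have h : cochainD K V (a.cmul μ f g) =
      a.cmul μ (cochainD K V f) g + (-1 : K) ^ 0 • a.cmul μ f (cochainD K V g) :=
    a.alg.leibniz μ 0 f hf g
  rw [pow_zero, one_smul] at h
  exact congrFun h .edge

/-- Locality and degree leave only products of a vertex with itself or with the edge. Symmetry
handles the right vertex times the edge, and the Leibniz rule applied to the four pairs of vertices
gives the rest. -/
theorem LocalDGAlg.cmul_eq : a.cmul = cochainMul O (halfMul a.cmul) := by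
  have er : ∀ μ x y, a.cmul μ (cellCochain K .edge x) (cellCochain K .right y) .edge =
    halfMul a.cmul μ x y := fun _ _ _ => rfl
  have re : ∀ μ x y, a.cmul μ (cellCochain K .right x) (cellCochain K .edge y) .edge =
      oppMul O (halfMul a.cmul) μ x y := by
    intro μ x y
    have h : a.cmul (O.swap μ) (cellCochain K .edge y) (cellCochain K .right x) =
        (-1 : K) ^ (1 * 0) • a.cmul μ (cellCochain K .right x) (cellCochain K .edge y) :=
      a.alg.mul_swap μ 1 0 _ (cellCochain_mem_grade .edge y) _ (cellCochain_mem_grade .right x)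
    rw [mul_zero, pow_zero, one_smul] at h
    rw [← h]
    rfl
  have lr : ∀ c, c ≠ Cell.edge → ∀ μ x y,
      a.cmul μ (cellCochain K .left x) (cellCochain K .right y) c = 0 := by
    intro c hc μ x y
    cases c with
    | left => exact a.cmul_vertex_right hc μ _ (cellCochain_of_ne (by simp) y)
    | right => exact a.cmul_vertex_left hc μ (cellCochain_of_ne (by simp) x) _
    | edge => exact absurd rfl hc
  have rl : ∀ c, c ≠ Cell.edge → ∀ μ x y,
      a.cmul μ (cellCochain K .right x) (cellCochain K .left y) c = 0 := by
    intro c hc μ x y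
    cases c with
    | left => exact a.cmul_vertex_left hc μ (cellCochain_of_ne (by simp) x) _
    | right => exact a.cmul_vertex_right hc μ _ (cellCochain_of_ne (by simp) y)
    | edge => exact absurd rfl hc
  -- The product of cochains on different vertices vanishes at both vertices. Its differential is
  -- therefore zero on the edge, and the Leibniz rule equates left times edge with edge times right.
  have le : ∀ μ x y, a.cmul μ (cellCochain K .left x) (cellCochain K .edge y) .edge =
      halfMul a.cmul μ x y := by
    intro μ x y
    have h := a.cmul_leibniz μ (g := cellCochain K .right y) (cellCochain_mem_grade .left x)
    rw [lr _ (by simp), lr _ (by simp), cochainD_cellCochain_left, cochainD_cellCochain_right,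
      map_neg, LinearMap.neg_apply, Pi.neg_apply, er] at h
    rw [sub_zero, eq_comm, neg_add_eq_zero] at h
    exact h.symm
  have el : ∀ μ x y, a.cmul μ (cellCochain K .edge x) (cellCochain K .left y) .edge =
      oppMul O (halfMul a.cmul) μ x y := by
    intro μ x y
    have h := a.cmul_leibniz μ (g := cellCochain K .left y) (cellCochain_mem_grade .right x)
    rw [rl _ (by simp), rl _ (by simp), cochainD_cellCochain_left, cochainD_cellCochain_right,
      map_neg, Pi.neg_apply, re] at h
    rw [sub_zero, eq_comm, add_neg_eq_zero] at h
    exact h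
  have rr : ∀ μ x y, a.cmul μ (cellCochain K .right x) (cellCochain K .right y) .right =
      halfMul a.cmul μ x y + oppMul O (halfMul a.cmul) μ x y := by
    intro μ x y
    have h := a.cmul_leibniz μ (g := cellCochain K .right y) (cellCochain_mem_grade .right x)
    rwa [a.cmul_vertex_left (c := .left) (by simp) μ (cellCochain_of_ne (by simp) x), sub_zero,
      cochainD_cellCochain_right, cochainD_cellCochain_right, er, re] at h
  -- The minus sign in the differential of a left cochain cancels the minus sign of the left value
  -- in the differential of the product.
  have ll : ∀ μ x y, a.cmul μ (cellCochain K .left x) (cellCochain K .left y) .left =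
      halfMul a.cmul μ x y + oppMul O (halfMul a.cmul) μ x y := by
    intro μ x y
    have h := a.cmul_leibniz μ (g := cellCochain K .left y) (cellCochain_mem_grade .left x)
    rw [a.cmul_vertex_left (c := .right) (by simp) μ (cellCochain_of_ne (by simp) x), zero_sub,
      cochainD_cellCochain_left, cochainD_cellCochain_left, map_neg, map_neg,
      LinearMap.neg_apply, Pi.neg_apply, Pi.neg_apply, el, le, ← neg_add, neg_inj] at h
    rw [h, add_comm]
  refine LinearMap.ext fun μ => LinearMap.ext₂ fun f g => funext fun c => ?_
  cases c with
  | left =>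
    rw [cochainMul_left, ← ll, ← sub_eq_zero]
    -- By locality each factor may be replaced by its part supported on this vertex.
    have e1 := a.cmul_vertex_left (c := .left) (by simp) μ
      (f := f - cellCochain K .left (f .left)) (by simp [cellCochain_same]) g
    have e2 := a.cmul_vertex_right (c := .left) (by simp) μ (cellCochain K .left (f .left))
      (g := g - cellCochain K .left (g .left)) (by simp [cellCochain_same])
    rw [map_sub, LinearMap.sub_apply, Pi.sub_apply, sub_eq_zero] at e1
    rw [map_sub, Pi.sub_apply, sub_eq_zero] at e2
    rw [e1, e2, sub_self]
  | right =>
    rw [cochainMul_right, ← rr, ← sub_eq_zero]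
    have e1 := a.cmul_vertex_left (c := .right) (by simp) μ
      (f := f - cellCochain K .right (f .right)) (by simp [cellCochain_same]) g
    have e2 := a.cmul_vertex_right (c := .right) (by simp) μ (cellCochain K .right (f .right))
      (g := g - cellCochain K .right (g .right)) (by simp [cellCochain_same])
    rw [map_sub, LinearMap.sub_apply, Pi.sub_apply, sub_eq_zero] at e1
    rw [map_sub, Pi.sub_apply, sub_eq_zero] at e2
    rw [e1, e2, sub_self]
  | edge =>
    rw [cochainMul_edge]
    conv_lhs => rw [eq_sum_cellCochain (K := K) f, eq_sum_cellCochain (K := K) g]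
    simp only [map_add, LinearMap.add_apply, Pi.add_apply, er, re, el, le]
    rw [a.cmul_eq_zero_of_dim (c := .left) (d := .left) (by simp [Cell.dim]),
      a.cmul_eq_zero_of_dim (c := .left) (d := .right) (by simp [Cell.dim]),
      a.cmul_eq_zero_of_dim (c := .right) (d := .left) (by simp [Cell.dim]),
      a.cmul_eq_zero_of_dim (c := .right) (d := .right) (by simp [Cell.dim]),
      a.cmul_eq_zero_of_dim (c := .edge) (d := .edge) (by simp [Cell.dim])]
    abel

theorem LocalDGAlg.assRel : AssRel O (halfMul a.cmul) := by
  rw [AssRel, halfRel_ass_iff]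
  intro r hr x
  -- Distinct vertices on the two sides of the edge isolate a single associativity relation: only
  -- two of the 36 terms in the edge component survive. Only one input has positive degree, so the
  -- Koszul signs are trivial.
  have h : nest a.cmul (r 0) (cellCochain K .left (x 0)) (cellCochain K .edge (x 1))
        (cellCochain K .right (x 2)) +
      (-1 : K) ^ (0 * (1 + 0)) • nest a.cmul (r 1) (cellCochain K .edge (x 1))
        (cellCochain K .right (x 2)) (cellCochain K .left (x 0)) +
      (-1 : K) ^ (0 * (0 + 1)) • nest a.cmul (r 2) (cellCochain K .right (x 2))
        (cellCochain K .left (x 0)) (cellCochain K .edge (x 1)) = 0 :=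
    a.alg.rel r hr 0 1 0 _ (cellCochain_mem_grade .left (x 0)) _
      (cellCochain_mem_grade .edge (x 1)) _ (cellCochain_mem_grade .right (x 2))
  rw [zero_mul, pow_zero, one_smul, one_smul, a.cmul_eq] at h
  have h' := congrFun h .edge
  simp only [Pi.add_apply, nest_cochainMul_edge, cellCochain_same,
    cellCochain_of_ne (show Cell.left ≠ .right by simp),
    cellCochain_of_ne (show Cell.left ≠ .edge by simp),
    cellCochain_of_ne (show Cell.right ≠ .left by simp),
    cellCochain_of_ne (show Cell.right ≠ .edge by simp),
    cellCochain_of_ne (show Cell.edge ≠ .left by simp),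
    cellCochain_of_ne (show Cell.edge ≠ .right by simp), nest₂_zero_left,
    nest₂_zero_middle, nest₂_zero_right, LinearMap.zero_apply,
    zero_add, add_zero, Pi.zero_apply] at h'
  exact h'

end Local

/-- The local dg algebra structure given by the products of `1`-cochains with `0`-cochains. -/
def LocalDGAlg.ofHalf (L : O.E →ₗ[K] V →ₗ[K] V →ₗ[K] V) (hL : AssRel O L) : LocalDGAlg O V where
  alg := DGAlg.ofUnsigned (A := cochains K V) cochainGrade_eq_zero (cochainMul O L)
    (fun μ _ _ f hf g hg => cochainMul_mem_grade L μ f g hf hg)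
    (fun μ _ f hf g => cochainMul_leibniz L μ f g hf)
    (fun μ f g => cochainMul_swap L μ f g)
    (fun _ hr f g h => hL.nest_cochainMul hr f g h)
  -- Closure under the differential is already contained in the construction of `relCochains`, and
  -- the second half of the ideal condition follows from the first by the symmetry of the products.
  isLocal X := ⟨fun f hf => ((relCochains K V X).d ⟨f, hf⟩ : vanishing K V X.cells).2,
    fun μ f hf g => ⟨cochainMul_mem_vanishing L μ f g X hf, 
      (congrArg (· ∈ vanishing K V X.cells) (cochainMul_swap L μ f g)).mp
        (cochainMul_mem_vanishing L (O.swap μ) f g X hf)⟩⟩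

/-- Local dg algebra structures are given by the products of `1`-cochains with `0`-cochains. -/
def LocalDGAlg.equivHalf (O : QuadOperad K) (V : Type u) [AddCommGroup V] [Module K V] :
    {L : O.E →ₗ[K] V →ₗ[K] V →ₗ[K] V // AssRel O L} ≃ LocalDGAlg O V where
  toFun L := LocalDGAlg.ofHalf L.1 L.2
  invFun a := ⟨halfMul a.cmul, a.assRel⟩
  left_inv L := Subtype.ext <| LinearMap.ext fun μ => LinearMap.ext₂ fun x y =>
    cochainMul_half L.1 μ x y
  right_inv a := LocalDGAlg.ext (DGAlg.ext a.cmul_eq.symm)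

theorem LocalDGAlg.ofHalf_isHom_iff {L : O.E →ₗ[K] V →ₗ[K] V →ₗ[K] V} (hL : AssRel O L)
    {L' : O.E →ₗ[K] W →ₗ[K] W →ₗ[K] W} (hL' : AssRel O L') (f : V →ₗ[K] W) :
    (∀ μ x y, f (L μ x y) = L' μ (f x) (f y)) ↔
      (LocalDGAlg.ofHalf L hL).alg.IsHom (LocalDGAlg.ofHalf L' hL').alg (cochainsMap f) := by
  refine ⟨fun h μ a b => funext fun c => cochainMul_map L L' f h μ a b c, fun h μ x y => ?_⟩
  have h' : f (cochainMul O L μ (cellCochain K .edge x) (cellCochain K .right y) .edge) =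
      cochainMul O L' μ (f ∘ cellCochain K .edge x) (f ∘ cellCochain K .right y) .edge :=
    congrFun (h μ (cellCochain K .edge x) (cellCochain K .right y)) Cell.edge
  rwa [comp_cellCochain, comp_cellCochain, cochainMul_half, cochainMul_half] at h'

theorem LocalDGAlg.ofHalf_comp (φ : O ⟶ P) {L : P.E →ₗ[K] V →ₗ[K] V →ₗ[K] V} (hL : AssRel P L)
    (hL' : AssRel O (L ∘ₗ QuadOperad.Hom.map φ)) :
    LocalDGAlg.ofHalf (L ∘ₗ QuadOperad.Hom.map φ) hL' = (LocalDGAlg.ofHalf L hL).restrict φ :=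
  LocalDGAlg.ext (DGAlg.ext (cochainMul_comp L φ))

/-- The algebras over the black products with `Ass`. -/
def assEquiv (K : Type u) [Field K] :
    AlgTypeEquiv (halfType (HalfRel {![prodOp K ⊗ₜ prodOp K, -(oppOp K ⊗ₜ prodOp K), 0]})
      HalfRel.comp) (assBullet K) where
  equiv O V _ _ := LocalDGAlg.equivHalf O V
  isHom_iff _ _ _ _ _ _ _ a b f := LocalDGAlg.ofHalf_isHom_iff a.2 b.2 f
  natural φ _ _ _ a := LocalDGAlg.ofHalf_comp φ a.2 (HalfRel.comp φ a.1 a.2)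

/-! ### The commutative case: trivial associated algebra -/

theorem ComRel.assRel {L : O.E →ₗ[K] V →ₗ[K] V →ₗ[K] V} (h : ComRel O L) : AssRel O L := by
  have neg : ∀ x y z : V, nest₂ (-L) L x y z = -nest₂ L L x y z :=
    fun x y z => TensorProduct.ext' fun _ _ => rfl
  rw [AssRel, halfRel_ass_iff]
  intro t ht x
  rw [h.1, neg, LinearMap.neg_apply, ← sub_eq_add_neg]
  exact h.2 t ht x

theorem AssRel.comRel {L : O.E →ₗ[K] V →ₗ[K] V →ₗ[K] V} (h : AssRel O L)
    (h' : oppMul O L = -L) : ComRel O L := by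
  have neg : ∀ x y z : V, nest₂ (-L) L x y z = -nest₂ L L x y z :=
    fun x y z => TensorProduct.ext' fun _ _ => rfl
  refine ⟨h', fun t ht x => ?_⟩
  have e := (halfRel_ass_iff L).1 h t ht x
  rwa [h', neg, LinearMap.neg_apply, ← sub_eq_add_neg] at e

/-- This is what links the two conditions: the associated algebra is trivial exactly when `L` is the
negative of its opposite, which is the first half of `ComRel`. -/
theorem LocalDGAlg.assoc_eq (a : LocalDGAlg O V) (μ : O.E) (x y : V) :
    a.assoc μ x y = halfMul a.cmul μ x y + oppMul O (halfMul a.cmul) μ x y := by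
  have h : a.assoc μ x y = a.cmul μ (rightCochain x) (rightCochain y) .right := rfl
  rw [h, a.cmul_eq, cochainMul_right, ← a.cmul_eq]
  rfl

/-- The algebras over the black products with `Com`. -/
def comEquiv (K : Type u) [Field K] : AlgTypeEquiv (halfType ComRel ComRel.comp) (comBullet K) where
  equiv O V _ _ :=
    { toFun := fun L => ⟨LocalDGAlg.ofHalf L.1 L.2.assRel, fun μ x y => by
        have h : (LocalDGAlg.ofHalf L.1 L.2.assRel).assoc μ x y =
          L.1 μ x y + oppMul O L.1 μ x y := rfl
        rw [h, L.2.1]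
        exact add_neg_cancel _⟩
      invFun := fun a => ⟨halfMul a.toLocal.cmul, a.toLocal.assRel.comRel <|
        LinearMap.ext fun μ => LinearMap.ext₂ fun x y => by
          have h := a.assoc_eq_zero μ x y
          rw [LocalDGAlg.assoc_eq] at h
          exact eq_neg_of_add_eq_zero_right h⟩
      left_inv := fun L => Subtype.ext <| LinearMap.ext fun μ => LinearMap.ext₂ fun x y =>
        cochainMul_half L.1 μ x y
      right_inv := fun a => TrivialLocalDGAlg.ext ((LocalDGAlg.equivHalf O V).right_inv a.toLocal) }
  isHom_iff _ _ _ _ _ _ _ a b f := LocalDGAlg.ofHalf_isHom_iff a.2.assRel b.2.assRel f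
  natural φ _ _ _ a := TrivialLocalDGAlg.ext (LocalDGAlg.ofHalf_comp φ a.2.assRel
    (ComRel.comp φ a.1 a.2).assRel)

/-! ### Structures on the cochains relative to the left vertex -/

section Relative

/-- The cochains that vanish on the left vertex. -/
abbrev RelCochain (K : Type u) [Field K] (V : Type u) [AddCommGroup V] [Module K V] :
    Submodule K (Cell → V) :=
  vanishing K V ClosedSub.leftVertex.cells

theorem RelCochain.left (f : RelCochain K V) : f.1 .left = 0 := f.2 .left rfl

/-- The products of relative cochains determined by those of `1`-cochains with `0`-cochains. -/
def relMul (O : QuadOperad K) (L : O.E →ₗ[K] V →ₗ[K] V →ₗ[K] V) :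
    O.E →ₗ[K] RelCochain K V →ₗ[K] RelCochain K V →ₗ[K] RelCochain K V where
  toFun μ := LinearMap.mk₂ K
    (fun f g => ⟨cochainMul O L μ f.1 g.1, cochainMul_mem_vanishing L μ f.1 g.1 _ f.2⟩)
    (fun f f' g => Subtype.ext (by simp))
    (fun k f g => Subtype.ext (by simp))
    (fun f g g' => Subtype.ext (by simp))
    (fun k f g => Subtype.ext (by simp))
  map_add' μ ν := by
    refine LinearMap.ext₂ fun f g => Subtype.ext ?_
    simp
  map_smul' k μ := by
    refine LinearMap.ext₂ fun f g => Subtype.ext ?_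
    simp

theorem relMul_coe (L : O.E →ₗ[K] V →ₗ[K] V →ₗ[K] V) (μ : O.E) (f g : RelCochain K V) :
    (relMul O L μ f g : Cell → V) = cochainMul O L μ f g := rfl

theorem nest_relMul (L : O.E →ₗ[K] V →ₗ[K] V →ₗ[K] V) (t : O.E ⊗[K] O.E)
    (f g h : RelCochain K V) :
    ((nest (relMul O L) t f g h : RelCochain K V) : Cell → V) = nest (cochainMul O L) t f g h := by
  rw [nest_eq_nest₂, nest_eq_nest₂]
  induction t using TensorProduct.induction_on with
  | zero => simp
  | tmul μ ν => rfl
  | add t t' e e' => rw [map_add, map_add, Submodule.coe_add, e, e']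

theorem PreLieRel.nest_relMul {L : O.E →ₗ[K] V →ₗ[K] V →ₗ[K] V} (hL : PreLieRel O L)
    {r : Free3 K O.E} (hr : r ∈ O.R) (f g h : RelCochain K V) :
    nest (relMul O L) (r 0) f g h + nest (relMul O L) (r 1) g h f +
      nest (relMul O L) (r 2) h f g = 0 := by
  refine Subtype.ext ?_
  simp only [Submodule.coe_add, BQ.nest_relMul]
  exact hL.nest_cochainMul hr (RelCochain.left f) (RelCochain.left g) (RelCochain.left h)

/-- The dg algebra structure on relative cochains given by the products of `1`-cochains with
`0`-cochains. -/
def DGAlg.ofHalf (L : O.E →ₗ[K] V →ₗ[K] V →ₗ[K] V) (hL : PreLieRel O L) :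
    DGAlg O (relCochains K V ClosedSub.leftVertex) :=
  DGAlg.ofUnsigned (A := relCochains K V ClosedSub.leftVertex)
    (fun n hn f hf => Subtype.ext (cochainGrade_eq_zero (K := K) n hn f.1 hf)) (relMul O L)
    (fun μ _ _ f hf g hg => cochainMul_mem_grade L μ f.1 g.1 hf hg)
    (fun μ _ f hf g => Subtype.ext (cochainMul_leibniz L μ f.1 g.1 hf))
    (fun μ f g => Subtype.ext (cochainMul_swap L μ f.1 g.1))
    (fun _ hr f g h => hL.nest_relMul hr f g h)

/-- The relative cochains supported on one simplex. -/
def relCell (K : Type u) [Field K] {V : Type u} [AddCommGroup V] [Module K V] (c : Cell)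
    (hc : c ≠ .left) : V →ₗ[K] RelCochain K V :=
  (cellCochain K c).codRestrict _ fun x _ h => cellCochain_of_ne (fun e => hc (e.trans h)) x

theorem eq_sum_relCell (f : RelCochain K V) : f = relCell K .right (by simp) (f.1 .right) +
    relCell K .edge (by simp) (f.1 .edge) := by
  refine Subtype.ext ((eq_sum_cellCochain (K := K) f.1).trans ?_)
  rw [RelCochain.left f, map_zero, zero_add]
  rfl

theorem relCell_mem_grade (c : Cell) (hc : c ≠ .left) (x : V) :
    relCell K c hc x ∈ (relCochains K V ClosedSub.leftVertex).grade c.dim :=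
  cellCochain_mem_grade c x

/-- The products of relative `1`-cochains with `0`-cochains. -/
def relHalfMul (m : O.E →ₗ[K] RelCochain K V →ₗ[K] RelCochain K V →ₗ[K] RelCochain K V) :
    O.E →ₗ[K] V →ₗ[K] V →ₗ[K] V where
  toFun μ := ((m μ).compl₁₂ (relCell K .edge (by simp)) (relCell K .right (by simp))).compr₂
    (LinearMap.proj .edge ∘ₗ Submodule.subtype _)
  map_add' μ ν := by refine LinearMap.ext₂ fun x y => ?_; simp
  map_smul' c μ := by refine LinearMap.ext₂ fun x y => ?_; simp

variable (a : DGAlg O (relCochains K V ClosedSub.leftVertex))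

/-- The products of a dg algebra structure on relative cochains. -/
def DGAlg.rmul : O.E →ₗ[K] RelCochain K V →ₗ[K] RelCochain K V →ₗ[K] RelCochain K V := a.mul

theorem DGAlg.rmul_eq_zero_of_dim {c d e : Cell} (h : e.dim ≠ c.dim + d.dim) (hc : c ≠ .left)
    (hd : d ≠ .left) (μ : O.E) (x y : V) :
    (a.rmul μ (relCell K c hc x) (relCell K d hd y) : Cell → V) e = 0 :=
  a.mul_mem μ _ _ _ (relCell_mem_grade c hc x) _ (relCell_mem_grade d hd y) e h

/-- No locality is needed here. The left value of every cochain is zero by construction, so degree,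
symmetry and one use of the Leibniz rule on two right cochains determine all products. -/
theorem DGAlg.rmul_eq : a.rmul = relMul O (relHalfMul a.rmul) := by
  let r : V →ₗ[K] RelCochain K V := relCell K .right (by simp)
  let e : V →ₗ[K] RelCochain K V := relCell K .edge (by simp)
  have er : ∀ μ x y, (a.rmul μ (e x) (r y) : Cell → V) .edge = relHalfMul a.rmul μ x y :=
    fun _ _ _ => rfl
  have re : ∀ μ x y, (a.rmul μ (r x) (e y) : Cell → V) .edge =
      oppMul O (relHalfMul a.rmul) μ x y := by
    intro μ x y
    have h : a.rmul (O.swap μ) (e y) (r x) = (-1 : K) ^ (1 * 0) • a.rmul μ (r x) (e y) :=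
      a.mul_swap μ 1 0 _ (relCell_mem_grade .edge (by simp) y) _
        (relCell_mem_grade .right (by simp) x)
    rw [mul_zero, pow_zero, one_smul] at h
    rw [← h]
    rfl
  have rr : ∀ μ x y, (a.rmul μ (r x) (r y) : Cell → V) .right =
      relHalfMul a.rmul μ x y + oppMul O (relHalfMul a.rmul) μ x y := by
    intro μ x y
    have dr : ∀ x, (relCochains K V ClosedSub.leftVertex).d (r x) = e x :=
      fun x => Subtype.ext (cochainD_cellCochain_right x)
    have h := a.leibniz μ 0 (r x) (relCell_mem_grade .right (by simp) x) (r y)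
    rw [dr, dr, pow_zero, one_smul] at h
    have h' : (a.rmul μ (r x) (r y) : Cell → V) .right - (a.rmul μ (r x) (r y) : Cell → V) .left =
      (a.rmul μ (e x) (r y) : Cell → V) .edge + (a.rmul μ (r x) (e y) : Cell → V) .edge :=
      congrFun (congrArg Subtype.val h) Cell.edge
    rwa [RelCochain.left, sub_zero, er, re] at h'
  refine LinearMap.ext fun μ => LinearMap.ext₂ fun f g => Subtype.ext (funext fun c => ?_)
  have dec : ∀ f : RelCochain K V, f = r (f.1 .right) + e (f.1 .edge) := eq_sum_relCell
  rw [relMul_coe]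
  cases c with
  | left => rw [RelCochain.left, cochainMul_left, RelCochain.left f]; simp
  | right =>
    rw [cochainMul_right]
    conv_lhs => rw [dec f, dec g]
    simp only [map_add, LinearMap.add_apply, Submodule.coe_add, Pi.add_apply, rr]
    rw [a.rmul_eq_zero_of_dim (c := .right) (d := .edge) (by simp [Cell.dim]),
      a.rmul_eq_zero_of_dim (c := .edge) (d := .right) (by simp [Cell.dim]),
      a.rmul_eq_zero_of_dim (c := .edge) (d := .edge) (by simp [Cell.dim])]
    simp only [add_zero]
  | edge =>
    rw [cochainMul_edge, RelCochain.left f, RelCochain.left g]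
    conv_lhs => rw [dec f, dec g]
    simp only [map_add, LinearMap.add_apply, Submodule.coe_add, Pi.add_apply, er, re]
    rw [a.rmul_eq_zero_of_dim (c := .right) (d := .right) (by simp [Cell.dim]),
      a.rmul_eq_zero_of_dim (c := .edge) (d := .edge) (by simp [Cell.dim])]
    simp only [map_zero, LinearMap.zero_apply]
    abel

theorem DGAlg.preLieRel : PreLieRel O (relHalfMul a.rmul) := by
  rw [PreLieRel, halfRel_preLie_iff]
  intro t ht x
  let r : V →ₗ[K] RelCochain K V := relCell K .right (by simp)
  let e : V →ₗ[K] RelCochain K V := relCell K .edge (by simp)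
  -- One edge and two right vertices: the two vertices can be multiplied together first, in two
  -- ways, or each can be multiplied with the edge. These are the four terms of the pre-Lie
  -- relation.
  have h : nest a.rmul (t 0) (e (x 0)) (r (x 1)) (r (x 2)) +
      (-1 : K) ^ (1 * (0 + 0)) • nest a.rmul (t 1) (r (x 1)) (r (x 2)) (e (x 0)) +
      (-1 : K) ^ (0 * (1 + 0)) • nest a.rmul (t 2) (r (x 2)) (e (x 0)) (r (x 1)) = 0 :=
    a.rel t ht 1 0 0 _ (relCell_mem_grade .edge (by simp) (x 0)) _
      (relCell_mem_grade .right (by simp) (x 1)) _ (relCell_mem_grade .right (by simp) (x 2))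
  rw [add_zero, mul_zero, zero_mul, pow_zero, one_smul, one_smul, a.rmul_eq] at h
  have h' := congrFun (congrArg Subtype.val h) Cell.edge
  have rl : ∀ x, (r x : Cell → V) .left = 0 := fun _ => rfl
  have rr : ∀ x, (r x : Cell → V) .right = x := fun _ => rfl
  have re : ∀ x, (r x : Cell → V) .edge = 0 := fun _ => rfl
  have el : ∀ x, (e x : Cell → V) .left = 0 := fun _ => rfl
  have er : ∀ x, (e x : Cell → V) .right = 0 := fun _ => rfl
  have ee : ∀ x, (e x : Cell → V) .edge = x := fun _ => rfl
  simp only [Submodule.coe_add, nest_relMul, Pi.add_apply, nest_cochainMul_edge, rl, rr, re, el,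
    er, ee, nest₂_zero_left,
    nest₂_zero_middle, nest₂_zero_right, LinearMap.zero_apply, zero_add, add_zero, Pi.zero_apply,
    Submodule.coe_zero] at h'
  exact h'

/-- The algebras over the black products with `PreLie`. -/
def preLieEquiv (K : Type u) [Field K] :
    AlgTypeEquiv (halfType (HalfRel {![prodOp K ⊗ₜ prodOp K,
      -(oppOp K ⊗ₜ prodOp K) + oppOp K ⊗ₜ oppOp K, -(prodOp K ⊗ₜ oppOp K)]}) HalfRel.comp)
      (preLieBullet K) where
  equiv O V _ _ :=
    { toFun := fun L => DGAlg.ofHalf L.1 L.2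
      invFun := fun a => ⟨relHalfMul a.rmul, a.preLieRel⟩
      left_inv := fun L => Subtype.ext <| LinearMap.ext fun μ => LinearMap.ext₂ fun x y =>
        cochainMul_half L.1 μ x y
      right_inv := fun a => DGAlg.ext a.rmul_eq.symm }
  isHom_iff O V W _ _ _ _ L L' f := by
    refine ⟨fun h μ a b => Subtype.ext (funext fun c => cochainMul_map L.1 L'.1 f h μ a.1 b.1 c),
      fun h μ x y => ?_⟩
    have h' : f (cochainMul O L.1 μ (cellCochain K .edge x) (cellCochain K .right y) .edge) =
        cochainMul O L'.1 μ (f ∘ cellCochain K .edge x) (f ∘ cellCochain K .right y) .edge :=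
      congrFun (congrArg Subtype.val (h μ (relCell K .edge (by simp) x)
        (relCell K .right (by simp) y))) Cell.edge
    rwa [comp_cellCochain, comp_cellCochain, cochainMul_half, cochainMul_half] at h'
  natural φ V _ _ L := DGAlg.ext <| LinearMap.ext fun μ => LinearMap.ext₂ fun f g =>
    Subtype.ext (LinearMap.congr_fun₂ (LinearMap.congr_fun (cochainMul_comp L.1 φ) μ) f.1 g.1)

end Relative

end Identification
end BQ

theorem theorem1p11 (K : Type u) [Field K] :
    ((∃ T : BQ.QuadOperad K ⥤ BQ.QuadOperad K, Nonempty (BQ.Represents T (BQ.assBullet K))) ∧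
      ∀ T : BQ.QuadOperad K ⥤ BQ.QuadOperad K, Nonempty (BQ.Represents T (BQ.assBullet K)) →
        Nonempty (T ≅ BQ.black (BQ.Ass K))) ∧
    ((∃ T : BQ.QuadOperad K ⥤ BQ.QuadOperad K, Nonempty (BQ.Represents T (BQ.comBullet K))) ∧
      ∀ T : BQ.QuadOperad K ⥤ BQ.QuadOperad K, Nonempty (BQ.Represents T (BQ.comBullet K)) →
        Nonempty (T ≅ BQ.black (BQ.Com K))) ∧
    ((∃ T : BQ.QuadOperad K ⥤ BQ.QuadOperad K, Nonempty (BQ.Represents T (BQ.preLieBullet K))) ∧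
      ∀ T : BQ.QuadOperad K ⥤ BQ.QuadOperad K, Nonempty (BQ.Represents T (BQ.preLieBullet K)) →
        Nonempty (T ≅ BQ.black (BQ.PreLie K))) := by
  have ass : BQ.Represents (BQ.black (BQ.Ass K)) (BQ.assBullet K) :=
    (BQ.representsHalf _).trans (BQ.assEquiv K)
  have com : BQ.Represents (BQ.black (BQ.Com K)) (BQ.comBullet K) :=
    BQ.representsCom.trans (BQ.comEquiv K)
  have preLie : BQ.Represents (BQ.black (BQ.PreLie K)) (BQ.preLieBullet K) :=
    (BQ.representsHalf _).trans (BQ.preLieEquiv K)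
  exact ⟨⟨⟨_, ⟨ass⟩⟩, fun T ⟨ρ⟩ => ⟨ρ.iso ass⟩⟩, ⟨⟨_, ⟨com⟩⟩, fun T ⟨ρ⟩ => ⟨ρ.iso com⟩⟩,
    ⟨⟨_, ⟨preLie⟩⟩, fun T ⟨ρ⟩ => ⟨ρ.iso preLie⟩⟩⟩
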